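/- Let $k$ be a field, and let $Q$ be a quiver with vertex set $\{1,\dots,n\}$ which is a tree (its underlying undirected multigraph is connected and has no loops, no multiple edges and no cycles). Let $I$ be an admissible ideal of the path algebra $kQ$, that is, a two-sided ideal with $R^m\subseteq I\subseteq R^2$ for some $m$, where $R$ is the ideal generated by the arrows. Let $A=kQ/I$ and denote by $e_i\in A$ the class of the trivial path at $i$. Modules are left modules, and a path $p$ from $i$ to $j$ lies in $e_j(kQ)e_i$. Put $P_i=Ae_i$ and $L_i=P_i/\operatorname{rad}P_i$, and order the simple modules $L_1,\dots,L_n$ of $A$ by $L_i\le_A L_j\Leftrightarrow i\le j$. The standard module $\Delta_i$ is the maximal factor module of $P_i$ with $[\Delta_i:L_j]=0$ for all $j>i$. Suppose that $(A,\le_A)$ is quasi-hereditary, i.e. the left module $A$ has a finite filtration with factors isomorphic to standard modules, and $\operatorname{End}_A(\Delta_i)\cong k$ for all $i$. A (unital) subalgebra $B$ of $A$ is called an exact Borel subalgebra of $(A,\le_A)$ if the functor $A\otimes_B-$ on finitely generated left $B$-modules is exact and the simple $B$-modules can be indexed, up to isomorphism and without repetition, as $S_1,\dots,S_n$ such that for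 all $i,j$: $A\otimes_B S_i\cong\Delta_i$; $\operatorname{End}_B(S_i)\cong\operatorname{End}_A(L_i)$; and $\operatorname{Ext}^1_B(S_i,S_j)\neq 0$ implies $i\le j$. A path in $A$ is a nonzero class $p+I$ of a path $p$ of $Q$; it is direction-preserving if $p$ runs from $i$ to $j$ with $i<j$. Let $B_{\max}$ be the subalgebra of $A$ generated by $e_1,\dots,e_n$ and all direction-preserving paths in $A$. An element $x\in A$ is called right-minimal direction-preserving if $x\in B_{\max}$ and $x\notin\operatorname{rad}(A)\operatorname{rad}(B_{\max})$ (this includes $x=e_i$). Let $B_{\min}$ be the subalgebra of $A$ generated by all paths in $A$ which are right-minimal direction-preserving. Then $A$ is monomial, i.e. $I$ is generated as a two-sided ideal by a set of paths of length at least two. Moreover, every exact Borel subalgebra $B$ of $(A,\le_A)$ is conjugate to $B_{\min}$: there is a unit $a\in A^\times$ such that $B=aB_{\min}a^{-1}$. -/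

import Mathlib

universe u v w

open TensorProduct

noncomputable section

/-! ### Path algebras -/

/-- The path algebra `k V` of a quiver with finite vertex set `V`: an element `x` is a finitely
supported family of coefficients of paths, `x i j` being the coefficients of the paths `i → j`. -/
def PathAlgebra (k : Type u) (V : Type w) [Quiver.{v} V] [Field k] : Type (max u v w) :=
  ∀ i j : V, Quiver.Path i j →₀ k

namespace PathAlgebra

variable {k : Type u} {V : Type w} [Quiver.{v} V] [Field k]

instance : AddCommGroup (PathAlgebra k V) :=
  inferInstanceAs (AddCommGroup (∀ i j : V, Quiver.Path i j →₀ k))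

instance : Module k (PathAlgebra k V) :=
  inferInstanceAs (Module k (∀ i j : V, Quiver.Path i j →₀ k))

/-- The bilinear extension of the composition of paths; in the product `p q` one first runs
through `q : i → j` and then through `p : j → l`. -/
def compLin {i j l : V} :
    (Quiver.Path j l →₀ k) →ₗ[k] (Quiver.Path i j →₀ k) →ₗ[k] (Quiver.Path i l →₀ k) :=
  Finsupp.linearCombination k fun p : Quiver.Path j l =>
    Finsupp.lmapDomain k k fun q : Quiver.Path i j => q.comp p

theorem compLin_single {i j l : V} (p : Quiver.Path j l) (q : Quiver.Path i j) (a b : k) :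
    compLin (Finsupp.single p a) (Finsupp.single q b) = Finsupp.single (q.comp p) (a * b) := by
  simp [compLin, Finsupp.mapDomain_single]

theorem compLin_assoc {i j l m : V} (x : Quiver.Path l m →₀ k) (y : Quiver.Path j l →₀ k)
    (z : Quiver.Path i j →₀ k) :
    compLin (compLin x y) z = compLin x (compLin y z) := by
  induction x using Finsupp.induction_linear with
  | zero => simp
  | add x x' hx hx' => simp [hx, hx']
  | single p a =>
    induction y using Finsupp.induction_linear with
    | zero => simp
    | add y y' hy hy' => simp [hy, hy']
    | single q b =>
      induction z using Finsupp.induction_linear with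
      | zero => simp
      | add z z' hz hz' => simp [hz, hz']
      | single r c => simp only [compLin_single, Quiver.Path.comp_assoc, mul_assoc]

theorem compLin_nil_left {i j : V} (y : Quiver.Path i j →₀ k) :
    compLin (Finsupp.single (Quiver.Path.nil : Quiver.Path j j) 1) y = y := by
  induction y using Finsupp.induction_linear with
  | zero => simp
  | add y y' hy hy' => simp [hy, hy']
  | single q b => simp only [compLin_single, Quiver.Path.comp_nil, one_mul]

theorem compLin_nil_right {i j : V} (x : Quiver.Path i j →₀ k) :
    compLin x (Finsupp.single (Quiver.Path.nil : Quiver.Path i i) 1) = x := by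
  induction x using Finsupp.induction_linear with
  | zero => simp
  | add x x' hx hx' => simp [hx, hx']
  | single p a => simp only [compLin_single, Quiver.Path.nil_comp, mul_one]

theorem add_apply (x y : PathAlgebra k V) (i j : V) : (x + y) i j = x i j + y i j := rfl

theorem smul_apply (a : k) (x : PathAlgebra k V) (i j : V) : (a • x) i j = a • x i j := rfl

theorem zero_apply (i j : V) : (0 : PathAlgebra k V) i j = 0 := rfl

instance [Fintype V] : Mul (PathAlgebra k V) where
  mul x y := fun i l => ∑ j : V, compLin (x j l) (y i j)

theorem mul_apply [Fintype V] (x y : PathAlgebra k V) (i l : V) :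
    (x * y) i l = ∑ j : V, compLin (x j l) (y i j) := rfl

variable [DecidableEq V]

/-- The basis element of the path algebra given by a path. -/
def ofPath {i j : V} (p : Quiver.Path i j) : PathAlgebra k V :=
  Pi.single (M := fun i : V => ∀ j : V, Quiver.Path i j →₀ k) i
    (Pi.single (M := fun j : V => Quiver.Path i j →₀ k) j (Finsupp.single p 1))

/-- The unit is the sum of all trivial paths. -/
instance : One (PathAlgebra k V) where
  one := fun i => Pi.single (M := fun j : V => Quiver.Path i j →₀ k) i
    (Finsupp.single Quiver.Path.nil 1)

theorem one_apply_self (i : V) :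
    (1 : PathAlgebra k V) i i = Finsupp.single Quiver.Path.nil 1 :=
  Pi.single_eq_same (M := fun j : V => Quiver.Path i j →₀ k) _ _

theorem one_apply_ne {i j : V} (h : j ≠ i) : (1 : PathAlgebra k V) i j = 0 :=
  Pi.single_eq_of_ne (M := fun j : V => Quiver.Path i j →₀ k) h _

variable [Fintype V]

instance : Ring (PathAlgebra k V) :=
  { (inferInstance : AddCommGroup (PathAlgebra k V)),
    (inferInstance : Mul (PathAlgebra k V)),
    (inferInstance : One (PathAlgebra k V)) with
    left_distrib := fun x y z => by
      funext i l
      simp [mul_apply, add_apply, Finset.sum_add_distrib]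
    right_distrib := fun x y z => by
      funext i l
      simp [mul_apply, add_apply, Finset.sum_add_distrib]
    zero_mul := fun x => by
      funext i l
      simp [mul_apply, zero_apply]
    mul_zero := fun x => by
      funext i l
      simp [mul_apply, zero_apply]
    mul_assoc := fun x y z => by
      funext i m
      simp only [mul_apply, map_sum, LinearMap.sum_apply, compLin_assoc]
      exact Finset.sum_comm
    one_mul := fun x => by
      funext i l
      rw [mul_apply, Finset.sum_eq_single l]
      · rw [one_apply_self, compLin_nil_left]
      · intro j _ hj
        rw [one_apply_ne hj.symm, map_zero, LinearMap.zero_apply]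
      · simp
    mul_one := fun x => by
      funext i l
      rw [mul_apply, Finset.sum_eq_single i]
      · rw [one_apply_self, compLin_nil_right]
      · intro j _ hj
        rw [one_apply_ne hj, map_zero]
      · simp }

instance : Algebra k (PathAlgebra k V) :=
  Algebra.ofModule
    (fun a x y => by
      funext i l
      simp [mul_apply, smul_apply, Finset.smul_sum])
    (fun a x y => by
      funext i l
      simp [mul_apply, smul_apply, Finset.smul_sum])

/-- `I` is an admissible ideal: `R ^ m ≤ I ≤ R ^ 2` for some `m`, where `R` is the ideal generated
by the arrows, so that `R ^ m` is the span of the paths of length at least `m`. -/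
def IsAdmissible (I : Ideal (PathAlgebra k V)) : Prop :=
  (∃ m : ℕ, ∀ (i j : V) (p : Quiver.Path i j), m ≤ p.length → ofPath p ∈ I) ∧
    I.restrictScalars k ≤ Submodule.span k
      {x | ∃ (i j : V) (p : Quiver.Path i j), 2 ≤ p.length ∧ x = ofPath p}

/-- `I` is generated, as a two-sided ideal, by a set of paths of length at least two. -/
def IsMonomial (I : Ideal (PathAlgebra k V)) : Prop :=
  ∃ S : Set (PathAlgebra k V),
    (∀ x ∈ S, ∃ (i j : V) (p : Quiver.Path i j), 2 ≤ p.length ∧ x = ofPath p) ∧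
      TwoSidedIdeal.asIdeal (TwoSidedIdeal.span S) = I

end PathAlgebra

/-- The quiver is a tree: its underlying undirected multigraph has no loops and no multiple edges,
and is a tree as a simple graph (connected, without cycles). -/
def IsTreeQuiver (V : Type w) [Quiver.{v} V] : Prop :=
  (∀ i : V, IsEmpty (i ⟶ i)) ∧
  (∀ i j : V, Subsingleton (i ⟶ j)) ∧
  (∀ i j : V, Nonempty (i ⟶ j) → IsEmpty (j ⟶ i)) ∧
  (SimpleGraph.fromRel fun i j : V => Nonempty (i ⟶ j)).IsTree

/-! ### Modules -/

/-- The simple module `L` occurs as a composition factor of `M`, that is, `[M : L] ≠ 0`. -/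
def IsCompositionFactor (A : Type w) [Ring A] (L M : Type w) [AddCommGroup L] [Module A L]
    [AddCommGroup M] [Module A M] : Prop :=
  ∃ U W : Submodule A M, U ⋖ W ∧ Nonempty ((W ⧸ U.submoduleOf W) ≃ₗ[A] L)

/-- `M` has a finite filtration whose factors are isomorphic to members of the family `D`. -/
def HasFiltration (A : Type w) [Ring A] {ι : Type} (D : ι → Type w) [∀ i, AddCommGroup (D i)]
    [∀ i, Module A (D i)] (M : Type w) [AddCommGroup M] [Module A M] : Prop :=
  ∃ (m : ℕ) (F : Fin (m + 1) → Submodule A M),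
    Monotone F ∧ F 0 = ⊥ ∧ F (Fin.last m) = ⊤ ∧
      ∀ l : Fin m, ∃ i : ι,
        Nonempty ((F l.succ ⧸ (F l.castSucc).submoduleOf (F l.succ)) ≃ₗ[A] D i)

/-- The relations `a b ⊗ x = a ⊗ b x` (`a ∈ A`, `b ∈ B`, `x ∈ M`) which define `A ⊗_B M`. -/
def balancedRel {A : Type w} [Ring A] {S : Type*} [SetLike S A] [SubringClass S A] (B : S)
    (M : Type w) [AddCommGroup M] [Module B M] : Submodule A (A ⊗[ℤ] M) :=
  Submodule.span A
    {t | ∃ (a : A) (b : B) (x : M), t = (a * (b : A)) ⊗ₜ[ℤ] x - a ⊗ₜ[ℤ] (b • x)}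

/-- The induced left `A`-module `A ⊗_B M` of a left module `M` over a subring `B` of `A`
(with `A` as a right `B`-module; `B` need not be commutative). -/
abbrev Induced {A : Type w} [Ring A] {S : Type*} [SetLike S A] [SubringClass S A] (B : S)
    (M : Type w) [AddCommGroup M] [Module B M] : Type w :=
  (A ⊗[ℤ] M) ⧸ balancedRel B M

/-- The induced map `id ⊗ f : A ⊗_B M → A ⊗_B N`. -/
def inducedMap {A : Type w} [Ring A] {S : Type*} [SetLike S A] [SubringClass S A] (B : S)
    {M N : Type w} [AddCommGroup M] [Module B M] [AddCommGroup N] [Module B N] (f : M →ₗ[B] N) :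
    Induced B M →ₗ[A] Induced B N :=
  Submodule.mapQ (balancedRel B M) (balancedRel B N)
    (TensorProduct.AlgebraTensorModule.map (LinearMap.id : A →ₗ[A] A)
      f.toAddMonoidHom.toIntLinearMap)
    (by
      rw [balancedRel, Submodule.span_le]
      rintro _ ⟨a, b, x, rfl⟩
      refine Submodule.subset_span ⟨a, b, f x, ?_⟩
      simp)

/-- The functor `A ⊗_B -` from finitely generated left `B`-modules to left `A`-modules is exact:
it preserves short exact sequences `0 → M → N → P → 0`. -/
def InductionExact {A : Type w} [Ring A] {S : Type*} [SetLike S A] [SubringClass S A]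
    (B : S) : Prop :=
  ∀ (M N P : Type w) [AddCommGroup M] [Module B M] [AddCommGroup N] [Module B N]
    [AddCommGroup P] [Module B P] [Module.Finite B M] [Module.Finite B N] [Module.Finite B P]
    (f : M →ₗ[B] N) (g : N →ₗ[B] P),
    Function.Injective f → Function.Exact f g → Function.Surjective g →
      Function.Injective (inducedMap B f) ∧ Function.Exact (inducedMap B f) (inducedMap B g) ∧
        Function.Surjective (inducedMap B g)

/-! ### Quasi-hereditary algebras and exact Borel subalgebras

`A` is an algebra with idempotents `e 0, …, e (n - 1)`, such that the modules `A e_i` are the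
indecomposable projectives and their tops `L_i` are, without repetition, the simple modules. The
simple modules are ordered by `L_i ≤ L_j ↔ i ≤ j`. -/

section QuasiHereditary

variable {A : Type w} [Ring A] {n : ℕ}

/-- `P_i = A e_i`. -/
abbrev projMod (e : Fin n → A) (i : Fin n) : Type w := ↥(Submodule.span A {e i})

/-- `L_i = P_i / rad P_i`. -/
abbrev simpleMod (e : Fin n → A) (i : Fin n) : Type w :=
  projMod e i ⧸ Module.jacobson A (projMod e i)

/-- The smallest submodule `U` of `P_i` such that `[P_i / U : L_j] = 0` for all `j > i`. -/
def stdKer (e : Fin n → A) (i : Fin n) : Submodule A (projMod e i) :=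
  sInf {U | ∀ j, i < j → ¬ IsCompositionFactor A (simpleMod e j) (projMod e i ⧸ U)}

/-- The standard module `Δ_i`: the maximal factor module of `P_i` with `[Δ_i : L_j] = 0` for all
`j > i`. -/
abbrev stdMod (e : Fin n → A) (i : Fin n) : Type w := projMod e i ⧸ stdKer e i

variable (k : Type u) [Field k] [Algebra k A]

/-- `(A, ≤)` is quasi-hereditary: `A` is filtered by standard modules, and `End_A(Δ_i) ≅ k`. -/
def IsQuasiHereditary (e : Fin n → A) : Prop :=
  HasFiltration A (stdMod e) A ∧
    ∀ i, Nonempty (Module.End A (stdMod e i) ≃ₐ[k] k)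

open scoped ModuleCat in
/-- `B` is an exact Borel subalgebra of `(A, ≤)`. The bijection `φ` between the isomorphism classes
of simple `B`-modules and those of simple `A`-modules is given by an indexing `S` of the former
by `Fin n`, with `φ [S i] = [L_i]`. -/
structure IsExactBorel (e : Fin n → A) (B : Subalgebra k A) : Prop where
  induction_exact : InductionExact B
  exists_simples : ∃ S : Fin n → ModuleCat.{w} B,
    (∀ i, IsSimpleModule B (S i)) ∧
    (∀ i j, Nonempty (S i ≃ₗ[B] S j) → i = j) ∧
    (∀ (M : Type w) [AddCommGroup M] [Module B M], IsSimpleModule B M →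
      ∃ i, Nonempty (M ≃ₗ[B] S i)) ∧
    (∀ i, Nonempty (Induced B (S i) ≃ₗ[A] stdMod e i)) ∧
    (∀ i, Nonempty (Module.End B (S i) ≃ₐ[k] Module.End A (simpleMod e i))) ∧
    (∀ i j, Nontrivial (CategoryTheory.Abelian.Ext.{w} (S i) (S j) 1) → i ≤ j)

end QuasiHereditary

/-! ### The subalgebra `B_min` of a quotient of a path algebra

The vertices of the quiver are `0, …, n - 1`. The quiver structure on `Fin n` is arbitrary. -/

section BMin

open PathAlgebra

variable {k : Type u} [Field k] {n : ℕ} [Quiver.{v} (Fin n)]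
  (I : Ideal (PathAlgebra k (Fin n))) [I.IsTwoSided]

/-- `x` is a path `i → j` in `A = k Q / I`, i.e. the nonzero class of a path `i → j` in `Q`. -/
def IsPathFromTo (i j : Fin n) (x : PathAlgebra k (Fin n) ⧸ I) : Prop :=
  x ≠ 0 ∧ ∃ p : Quiver.Path i j, x = Ideal.Quotient.mk I (ofPath p)

/-- The idempotent of `A = k Q / I` given by the trivial path at `i`. -/
def vertexIdem (i : Fin n) : PathAlgebra k (Fin n) ⧸ I :=
  Ideal.Quotient.mk I (ofPath (Quiver.Path.nil : Quiver.Path i i))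

/-- `B_max`: generated by the trivial paths and the direction-preserving paths `i → j`, `i < j`. -/
def bMax : Subalgebra k (PathAlgebra k (Fin n) ⧸ I) :=
  Algebra.adjoin k
    (Set.range (vertexIdem I) ∪ {x | ∃ i j : Fin n, i < j ∧ IsPathFromTo I i j x})

/-- `rad(A) rad(B_max)`, the span of the products of elements of the two radicals. -/
def radMulRad : Submodule k (PathAlgebra k (Fin n) ⧸ I) :=
  (Ring.jacobson (PathAlgebra k (Fin n) ⧸ I)).restrictScalars k *
    ((Ring.jacobson (bMax I)).restrictScalars k).map (bMax I).val.toLinearMap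

/-- `x` is right-minimal direction-preserving (this includes the trivial paths). -/
def IsRightMinimal (x : PathAlgebra k (Fin n) ⧸ I) : Prop :=
  x ∈ bMax I ∧ x ∉ radMulRad I

/-- `B_min`: generated by the right-minimal direction-preserving paths. -/
def bMin : Subalgebra k (PathAlgebra k (Fin n) ⧸ I) :=
  Algebra.adjoin k {x | (∃ i j : Fin n, IsPathFromTo I i j x) ∧ IsRightMinimal I x}

end BMin

end

/-! In a tree quiver there is at most one path between two vertices, so every `e_j A e_i` is at most
one-dimensional and the paths form a basis that is multiplicative up to zero and triangular for a
height function. This is what `ThinBasis` records. It gives monomiality at once: cutting an element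
of `I` by trivial paths leaves multiples of single paths, and these have length at least two by
admissibility.

Let `B` be an exact Borel subalgebra. The top of `Δ_i ≅ A ⊗_B S_i` yields a functional on `S_i` that
is semilinear for the `i`-th character of `A`. As the `S_i` are pairwise non-isomorphic, `B`
separates the characters, and lifting idempotents puts a conjugate of every `e_i` into `B`
(`exists_conj_idem_mem`). After conjugation `B` is spanned by the basis elements it contains, so it
is determined by a relation on the vertices.

Two facts determine this relation. Comparing where `e_j` vanishes on `Δ_i` and on `A ⊗_B S_i`
(`idem_smul_stdMod_eq_zero_iff`, `induced_char_iff`) shows that a basis element starting at `i`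
factors through some `m > i` exactly when it factors through some element `i → m` of `B` with `m ≠
i`; hence `B` contains all minimal basis elements. Exactness (`exists_through_of_inductionExact`)
shows that whenever `i → j` and `i → m` lie in `B` and the first factors through the second, the
remainder `m → j` is trivial or starts with a nontrivial element of `B`; peeling off minimal
elements then writes every basis element of `B` as a product of minimal ones
(`elt_mem_minSubalgebra`). Finally the radicals are common kernels of characters, which identifies
right-minimal paths with trivial paths and minimal basis elements (`isRightMinimal_iff`). -/

noncomputable section

/-! ### Thin bases: coefficients, characters, radicals and conjugation. -/

/-- A `k`-algebra `A` with orthogonal idempotents `elt i i` whose sum is `1` and with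
`elt j j * A * elt i i` spanned by the single element `elt j i`, such that nonzero basis elements multiply to basis elements and all `elt j i` with
`j ≠ i` increase a height function. -/
structure ThinBasis (k : Type u) (A : Type w) (V : Type*) [Field k] [Ring A] [Algebra k A]
    [Fintype V] where
  /-- The generator of `elt j j * A * elt i i`. -/
  elt : V → V → A
  /-- The height function. -/
  height : V → ℕ
  sum_elt_self : ∑ i, elt i i = 1
  elt_self_ne_zero : ∀ i, elt i i ≠ 0
  mul_of_ne : ∀ {l j j' i}, j ≠ j' → elt l j * elt j' i = 0
  mul_of_ne_zero : ∀ {l j i}, elt l j ≠ 0 → elt j i ≠ 0 → elt l j * elt j i = elt l i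
  height_lt : ∀ {j i}, elt j i ≠ 0 → j ≠ i → height i < height j
  exists_coeff : ∀ x j i, ∃ c : k, elt j j * x * elt i i = c • elt j i

namespace ThinBasis

variable {k : Type u} {A : Type w} {V : Type*} [Field k] [Ring A] [Algebra k A] [Fintype V]
  (T : ThinBasis k A V)

/-- The product `elt j m * elt m i` is nonzero. -/
def Through (j m i : V) : Prop := T.elt j m * T.elt m i ≠ 0

variable {T} in
theorem Through.left {j m i : V} (h : T.Through j m i) : T.elt j m ≠ 0 := left_ne_zero_of_mul h

variable {T} in
theorem Through.right {j m i : V} (h : T.Through j m i) : T.elt m i ≠ 0 := right_ne_zero_of_mul h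

variable {T} in
theorem Through.mul_eq {j m i : V} (h : T.Through j m i) :
    T.elt j m * T.elt m i = T.elt j i :=
  T.mul_of_ne_zero h.left h.right

variable {T} in
theorem Through.ne_zero {j m i : V} (h : T.Through j m i) : T.elt j i ≠ 0 :=
  h.mul_eq ▸ h

theorem elt_self_mul (j i : V) : T.elt j j * T.elt j i = T.elt j i := by
  by_cases h : T.elt j i = 0
  · simp [h]
  · exact T.mul_of_ne_zero (T.elt_self_ne_zero j) h

theorem mul_elt_self (j i : V) : T.elt j i * T.elt i i = T.elt j i := by
  by_cases h : T.elt j i = 0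
  · simp [h]
  · exact T.mul_of_ne_zero h (T.elt_self_ne_zero i)

theorem through_left {j i : V} (h : T.elt j i ≠ 0) : T.Through j j i := by
  rwa [Through, elt_self_mul]

theorem through_right {j i : V} (h : T.elt j i ≠ 0) : T.Through j i i := by
  rwa [Through, mul_elt_self]

variable {T} in
/-- If `l → j → i` factors and `j → m → i` factors, then so do `l → m → i` and `l → j → m`. -/
theorem Through.trans {l j m i : V} (h : T.Through l j i) (h' : T.Through j m i) :
    T.Through l m i ∧ T.Through l j m := by
  have h1 : T.elt l j * T.elt j m * T.elt m i ≠ 0 := by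
    rw [mul_assoc, h'.mul_eq]; exact h
  have h2 : T.Through l j m := left_ne_zero_of_mul h1
  refine ⟨?_, h2⟩
  rwa [h2.mul_eq] at h1

variable {T} in
theorem Through.trans' {l j m i : V} (h : T.Through l m i) (h' : T.Through l j m) :
    T.Through l j i ∧ T.Through j m i := by
  have h1 : T.elt l j * (T.elt j m * T.elt m i) ≠ 0 := by
    rw [← mul_assoc, h'.mul_eq]; exact h
  have h2 : T.Through j m i := right_ne_zero_of_mul h1
  refine ⟨?_, h2⟩
  rwa [h2.mul_eq] at h1

theorem eq_of_ne_zero {j i : V} (h : T.elt j i ≠ 0) (h' : T.elt i j ≠ 0) : j = i := by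
  by_contra hne
  exact lt_asymm (T.height_lt h hne) (T.height_lt h' (Ne.symm hne))

/-- The coefficient of `elt j i` (zero if `elt j i = 0`). -/
def coeff (j i : V) : A →ₗ[k] k :=
  open Classical in
  if h : T.elt j i = 0 then 0 else
    { toFun x := (T.exists_coeff x j i).choose
      map_add' x y := smul_left_injective k h <| by
        have hx := (T.exists_coeff x j i).choose_spec
        have hy := (T.exists_coeff y j i).choose_spec
        have hxy := (T.exists_coeff (x + y) j i).choose_spec
        simp only [add_smul]
        rw [← hxy, ← hx, ← hy, mul_add, add_mul]
      map_smul' c x := smul_left_injective k h <| by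
        have hx := (T.exists_coeff x j i).choose_spec
        have hcx := (T.exists_coeff (c • x) j i).choose_spec
        simp only [RingHom.id_apply, smul_eq_mul, mul_smul]
        rw [← hcx, ← hx, mul_smul_comm, smul_mul_assoc] }

theorem coeff_of_eq_zero {j i : V} (h : T.elt j i = 0) : T.coeff j i = 0 := by
  simp [coeff, h]

theorem elt_ne_zero_of_coeff {j i : V} {x : A} (h : T.coeff j i x ≠ 0) : T.elt j i ≠ 0 :=
  fun h0 => h (by rw [T.coeff_of_eq_zero h0, LinearMap.zero_apply])

theorem elt_mul_mul_elt (x : A) (j i : V) :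
    T.elt j j * x * T.elt i i = T.coeff j i x • T.elt j i := by
  by_cases h : T.elt j i = 0
  · obtain ⟨c, hc⟩ := T.exists_coeff x j i
    rw [hc, h, smul_zero, smul_zero]
  · have := (T.exists_coeff x j i).choose_spec
    simpa [coeff, h] using this

theorem coeff_eq_of_eq {j i : V} (h : T.elt j i ≠ 0) {x : A} {c : k}
    (hx : T.elt j j * x * T.elt i i = c • T.elt j i) : T.coeff j i x = c :=
  smul_left_injective k h (by simpa only [T.elt_mul_mul_elt] using hx)

theorem elt_mul (x : A) (j : V) : T.elt j j * x = ∑ i, T.coeff j i x • T.elt j i := by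
  simp_rw [← T.elt_mul_mul_elt, ← Finset.mul_sum, T.sum_elt_self, mul_one]

theorem mul_elt (x : A) (i : V) : x * T.elt i i = ∑ j, T.coeff j i x • T.elt j i := by
  simp_rw [← T.elt_mul_mul_elt, ← Finset.sum_mul, T.sum_elt_self, one_mul]

theorem eq_sum (x : A) : x = ∑ j, ∑ i, T.coeff j i x • T.elt j i := by
  simp_rw [← T.elt_mul, ← Finset.sum_mul, T.sum_elt_self, one_mul]

theorem ext_coeff {x y : A} (h : ∀ j i, T.coeff j i x = T.coeff j i y) : x = y := by
  rw [T.eq_sum x, T.eq_sum y]; simp_rw [h]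

theorem coeff_elt_self {j i : V} (h : T.elt j i ≠ 0) : T.coeff j i (T.elt j i) = 1 :=
  T.coeff_eq_of_eq h (by rw [elt_self_mul, mul_elt_self, one_smul])

theorem coeff_elt_of_ne {j i j' i' : V} (h : ¬ (j = j' ∧ i = i')) :
    T.coeff j i (T.elt j' i') = 0 := by
  by_cases h0 : T.elt j i = 0
  · rw [T.coeff_of_eq_zero h0, LinearMap.zero_apply]
  refine T.coeff_eq_of_eq h0 ?_
  rw [zero_smul]
  by_cases hj : j = j'
  · rw [mul_assoc, T.mul_of_ne (fun hi => h ⟨hj, hi.symm⟩), mul_zero]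
  · rw [T.mul_of_ne hj, zero_mul]

-- Expanding `e_j x` and `y e_i` in the basis, only equal middle vertices survive; the condition
-- `Through` discards those at which the two basis elements multiply to zero.
open Classical in
theorem coeff_mul (j i : V) (x y : A) : T.coeff j i (x * y) =
    ∑ m, if T.Through j m i then T.coeff j m x * T.coeff m i y else 0 := by
  by_cases h0 : T.elt j i = 0
  · rw [T.coeff_of_eq_zero h0, LinearMap.zero_apply, Finset.sum_eq_zero]
    intro m _
    rw [if_neg fun h => h.ne_zero h0]
  refine T.coeff_eq_of_eq h0 ?_
  rw [← mul_assoc, mul_assoc, T.elt_mul, T.mul_elt, Finset.sum_mul_sum, Finset.sum_smul]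
  refine Finset.sum_congr rfl fun m _ => ?_
  rw [Finset.sum_eq_single m]
  · rw [smul_mul_smul_comm]
    split_ifs with h
    · rw [h.mul_eq]
    · rw [not_not.mp h, smul_zero, zero_smul]
  · intro m' _ hne
    rw [smul_mul_smul_comm, T.mul_of_ne hne.symm, smul_zero]
  · simp

theorem exists_of_coeff_mul_ne_zero {j i : V} {x y : A} (h : T.coeff j i (x * y) ≠ 0) :
    ∃ m, T.Through j m i ∧ T.coeff j m x ≠ 0 ∧ T.coeff m i y ≠ 0 := by
  classical
  rw [T.coeff_mul] at h
  obtain ⟨m, _, hm⟩ := Finset.exists_ne_zero_of_sum_ne_zero h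
  rw [ite_ne_right_iff] at hm
  exact ⟨m, hm.1, left_ne_zero_of_mul hm.2, right_ne_zero_of_mul hm.2⟩

theorem coeff_mul_of_unique {j i : V} (x y : A) (m : V) (hm : T.Through j m i)
    (h : ∀ m', T.Through j m' i → T.coeff j m' x ≠ 0 → T.coeff m' i y ≠ 0 → m' = m) :
    T.coeff j i (x * y) = T.coeff j m x * T.coeff m i y := by
  classical
  rw [T.coeff_mul, Finset.sum_eq_single m, if_pos hm]
  · intro m' _ hne
    rw [ite_eq_right_iff]
    intro ht
    by_contra h0
    exact hne (h m' ht (left_ne_zero_of_mul h0) (right_ne_zero_of_mul h0))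
  · simp

theorem coeff_one_self (i : V) : T.coeff i i 1 = 1 :=
  T.coeff_eq_of_eq (T.elt_self_ne_zero i) (by rw [mul_one, elt_self_mul, one_smul])

/-- The character of `A` given by the coefficient of `elt i i`. -/
def char (i : V) : A →ₐ[k] k :=
  AlgHom.ofLinearMap (T.coeff i i) (T.coeff_one_self i) fun x y =>
    -- Multiplicativity holds because a factorization of `elt i i` through `m` forces `m = i`, by
    -- the height.
    T.coeff_mul_of_unique x y i (T.through_left (T.elt_self_ne_zero i)) fun _ h _ _ =>
      T.eq_of_ne_zero h.right h.left

theorem char_apply (i : V) (x : A) : T.char i x = T.coeff i i x := rfl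

theorem char_elt_self (i : V) : T.char i (T.elt i i) = 1 :=
  T.coeff_elt_self (T.elt_self_ne_zero i)

theorem char_elt_of_ne {l j i : V} (h : j ≠ i) : T.char l (T.elt j i) = 0 :=
  T.coeff_elt_of_ne fun h' => h (h'.1.symm.trans h'.2)

/-- Without diagonal coefficients, each factor of the power raises the height by at least one. -/
theorem height_add_le_of_coeff_pow {x : A} (hx : ∀ i, T.char i x = 0) (t : ℕ) {j i : V}
    (h : T.coeff j i (x ^ t) ≠ 0) : T.height i + t ≤ T.height j := by
  induction t generalizing j with
  | zero =>
    by_cases hji : j = i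
    · simp [hji]
    · exact (T.height_lt (T.elt_ne_zero_of_coeff h) hji).le
  | succ t ih =>
    rw [pow_succ'] at h
    obtain ⟨m, hm, h1, h2⟩ := T.exists_of_coeff_mul_ne_zero h
    have := ih h2
    have := T.height_lt hm.left (fun hjm => h1 (hjm ▸ hx j))
    omega

theorem isNilpotent_of_char_eq_zero {x : A} (hx : ∀ i, T.char i x = 0) : IsNilpotent x := by
  -- This exponent exceeds every height.
  refine ⟨∑ i, T.height i + 1, T.ext_coeff fun j i => ?_⟩
  by_contra h
  rw [map_zero] at h
  have h1 := T.height_add_le_of_coeff_pow hx _ h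
  have h2 := Finset.single_le_sum (fun l _ => Nat.zero_le (T.height l)) (Finset.mem_univ j)
  omega

/-- The Jacobson radical of a subalgebra of `A` is the common kernel of the characters of `A`. -/
theorem mem_jacobson_iff {C : Type*} [Ring C] [Algebra k C] {f : C →ₐ[k] A}
    (hf : Function.Injective f) (x : C) : x ∈ Ring.jacobson C ↔ ∀ i, T.char i (f x) = 0 := by
  rw [← Ideal.jacobson_bot, Ideal.mem_jacobson_iff]
  constructor
  · intro h i
    by_contra h0
    -- With this multiplier the character sends `1 + y * x` to zero, which is incompatible with a
    -- left inverse.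
    obtain ⟨z, hz⟩ := h (algebraMap k C (-(T.char i (f x))⁻¹))
    have := congrArg (fun y : C => T.char i (f y)) (Ideal.mem_bot.mp hz)
    simp [mul_assoc, h0] at this
  · intro h y
    have hnil : IsNilpotent (y * x) := (IsNilpotent.map_iff hf).mp
      (T.isNilpotent_of_char_eq_zero fun i => by simp [h i])
    obtain ⟨z, hz⟩ := hnil.isUnit_add_one.exists_left_inv
    refine ⟨z, Ideal.mem_bot.mpr ?_⟩
    rw [mul_assoc, ← mul_add_one, hz, sub_self]

/-- Conjugation of a thin basis by a unit. -/
def conj (a : Aˣ) : ThinBasis k A V where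
  elt j i := a * T.elt j i * ↑a⁻¹
  height := T.height
  sum_elt_self := by
    rw [← Finset.sum_mul, ← Finset.mul_sum, T.sum_elt_self, mul_one, Units.mul_inv]
  elt_self_ne_zero i := by simpa using T.elt_self_ne_zero i
  mul_of_ne {l j j' i} h := by
    have : a * T.elt l j * ↑a⁻¹ * (a * T.elt j' i * ↑a⁻¹) =
      a * (T.elt l j * T.elt j' i) * ↑a⁻¹ := by simp [mul_assoc]
    rw [this, T.mul_of_ne h, mul_zero, zero_mul]
  mul_of_ne_zero {l j i} h h' := by
    have : a * T.elt l j * ↑a⁻¹ * (a * T.elt j i * ↑a⁻¹) =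
      a * (T.elt l j * T.elt j i) * ↑a⁻¹ := by simp [mul_assoc]
    rw [this, T.mul_of_ne_zero (by simpa using h) (by simpa using h')]
  height_lt h hne := T.height_lt (by simpa using h) hne
  exists_coeff x j i := by
    obtain ⟨c, hc⟩ := T.exists_coeff (↑a⁻¹ * x * a) j i
    refine ⟨c, ?_⟩
    rw [← smul_mul_assoc, ← mul_smul_comm, ← hc]
    simp [mul_assoc]

theorem conj_elt (a : Aˣ) (j i : V) : (T.conj a).elt j i = a * T.elt j i * ↑a⁻¹ := rfl

theorem conj_elt_eq_zero (a : Aˣ) {j i : V} : (T.conj a).elt j i = 0 ↔ T.elt j i = 0 := by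
  simp [conj_elt]

theorem conj_through (a : Aˣ) {j m i : V} : (T.conj a).Through j m i ↔ T.Through j m i := by
  have : a * T.elt j m * ↑a⁻¹ * (a * T.elt m i * ↑a⁻¹) =
      a * (T.elt j m * T.elt m i) * ↑a⁻¹ := by simp [mul_assoc]
  simp [Through, conj_elt, this]

/-- Conjugation does not change the characters. -/
theorem conj_char (a : Aˣ) (i : V) (x : A) : (T.conj a).char i x = T.char i x := by
  refine (T.conj a).coeff_eq_of_eq ((T.conj a).elt_self_ne_zero i) ?_
  have h := T.elt_mul_mul_elt (↑a⁻¹ * x * a) i i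
  rw [← T.char_apply] at h
  have h1 : T.char i (↑a⁻¹ * x * a) = T.char i x := by
    rw [map_mul, map_mul, mul_comm, ← mul_assoc, ← map_mul, Units.mul_inv, map_one, one_mul]
  rw [h1] at h
  rw [conj_elt, ← smul_mul_assoc, ← mul_smul_comm, ← h]
  simp [mul_assoc]

end ThinBasis

/-! ### Projective, simple and standard modules over an algebra with a thin basis. -/

namespace ThinBasis

variable {k : Type u} {A : Type w} [Field k] [Ring A] [Algebra k A] {n : ℕ}
  (T : ThinBasis k A (Fin n))

/-- The idempotents `elt i i`. -/
abbrev idem (i : Fin n) : A := T.elt i i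

theorem mul_idem_of_mem {i : Fin n} (x : projMod T.idem i) : (x : A) * T.idem i = x := by
  obtain ⟨a, ha⟩ := Submodule.mem_span_singleton.mp x.2
  rw [← ha, smul_eq_mul, mul_assoc, T.elt_self_mul]

/-- `elt j i` as an element of the projective module `A e_i`. -/
def projElt (j i : Fin n) : projMod T.idem i :=
  ⟨T.elt j i, Submodule.mem_span_singleton.mpr ⟨T.elt j i, T.mul_elt_self j i⟩⟩

theorem smul_projElt_self {i : Fin n} (x : projMod T.idem i) :
    (x : A) • T.projElt i i = x :=
  Subtype.ext (T.mul_idem_of_mem x)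

theorem idem_smul {i : Fin n} (j : Fin n) (x : projMod T.idem i) :
    T.idem j • x = algebraMap k A (T.coeff j i x) • T.projElt j i := by
  refine Subtype.ext ?_
  change T.idem j * (x : A) = algebraMap k A (T.coeff j i x) * T.elt j i
  rw [← Algebra.smul_def, ← T.elt_mul_mul_elt, mul_assoc, T.mul_idem_of_mem]

/-- The elements of `A e_i` on which the character of `i` vanishes. -/
def projRad (i : Fin n) : Submodule A (projMod T.idem i) where
  carrier := {x | T.char i x = 0}
  add_mem' {x y} hx hy := by
    have hx : T.char i x = 0 := hx
    have hy : T.char i y = 0 := hy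
    simp [hx, hy]
  zero_mem' := by simp
  smul_mem' a x hx := by
    have hx : T.char i x = 0 := hx
    simp [hx]

theorem mem_projRad {i : Fin n} {x : projMod T.idem i} : x ∈ T.projRad i ↔ T.char i x = 0 :=
  Iff.rfl

theorem eq_top_of_projElt_mem {i : Fin n} {U : Submodule A (projMod T.idem i)}
    (h : T.projElt i i ∈ U) : U = ⊤ :=
  Submodule.eq_top_iff'.mpr fun x => T.smul_projElt_self x ▸ U.smul_mem _ h

/-- If the character of `i` does not vanish at `x`, then `e_i x` is a nonzero multiple of the
generator `e_i`. So `projRad` is the only maximal submodule. -/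
theorem le_projRad {i : Fin n} {U : Submodule A (projMod T.idem i)} (hU : U ≠ ⊤) :
    U ≤ T.projRad i := by
  intro x hx
  rw [mem_projRad]
  by_contra h0
  refine hU (T.eq_top_of_projElt_mem ?_)
  have h1 := U.smul_mem (algebraMap k A (T.char i x)⁻¹) (U.smul_mem (T.idem i) hx)
  rw [T.idem_smul, ← T.char_apply, smul_smul, ← map_mul, inv_mul_cancel₀ h0, map_one,
    one_smul] at h1
  exact h1

theorem projRad_ne_top (i : Fin n) : T.projRad i ≠ ⊤ := by
  intro h
  have h1 : T.projElt i i ∈ T.projRad i := h ▸ Submodule.mem_top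
  rw [mem_projRad] at h1
  exact one_ne_zero ((T.char_elt_self i).symm.trans h1)

theorem isCoatom_projRad (i : Fin n) : IsCoatom (T.projRad i) :=
  ⟨T.projRad_ne_top i, fun _ hU => by
    by_contra h
    exact hU.not_ge (T.le_projRad h)⟩

theorem jacobson_projMod (i : Fin n) : Module.jacobson A (projMod T.idem i) = T.projRad i :=
  le_antisymm (sInf_le (T.isCoatom_projRad i)) (le_sInf fun _ hU => by
    rcases (T.le_projRad hU.1).eq_or_lt with h | h
    · exact h.ge
    · exact absurd (hU.2 _ h) (T.projRad_ne_top i))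

theorem idem_smul_simpleMod_ne_zero (j : Fin n) :
    T.idem j • (Submodule.Quotient.mk (T.projElt j j) : simpleMod T.idem j) ≠ 0 := by
  rw [← Submodule.Quotient.mk_smul, Ne, Submodule.Quotient.mk_eq_zero, T.jacobson_projMod,
    T.mem_projRad]
  change ¬ T.char j (T.idem j * T.elt j j) = 0
  rw [map_mul, T.char_elt_self]
  simp

/-- `L_j` is a composition factor of `M` if and only if `e_j M ≠ 0`. -/
theorem isCompositionFactor_iff (j : Fin n) (M : Type w) [AddCommGroup M] [Module A M] :
    IsCompositionFactor A (simpleMod T.idem j) M ↔ ∃ x : M, T.idem j • x ≠ 0 := by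
  constructor
  · rintro ⟨U, W, -, ⟨g⟩⟩
    by_contra! h
    refine T.idem_smul_simpleMod_ne_zero j (g.symm.injective ?_)
    rw [map_smul, map_zero]
    obtain ⟨x, hx⟩ := Submodule.Quotient.mk_surjective _
      (g.symm (Submodule.Quotient.mk (T.projElt j j)))
    rw [← hx, ← Submodule.Quotient.mk_smul]
    have : T.idem j • x = 0 := Subtype.ext (h x)
    rw [this, Submodule.Quotient.mk_zero]
  · rintro ⟨x, hx⟩
    let φ : projMod T.idem j →ₗ[A] M :=
      (LinearMap.toSpanSingleton A M x).comp (Submodule.subtype _)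
    have hφ : ∀ y, φ y = (y : A) • x := fun y => rfl
    have hker : LinearMap.ker φ ≤ T.projRad j := by
      refine T.le_projRad fun h => hx ?_
      have h1 : T.projElt j j ∈ LinearMap.ker φ := h ▸ Submodule.mem_top
      exact h1
    let ρ := φ.rangeRestrict
    have hρ : LinearMap.range ρ = ⊤ := LinearMap.range_rangeRestrict φ
    -- The kernel of `φ` lies in the radical, so the image of `φ` modulo the image of the radical is
    -- still `L_j`.
    let U := (T.projRad j).map φ
    let W := LinearMap.range φ
    let τ : projMod T.idem j →ₗ[A] W ⧸ U.submoduleOf W := (Submodule.mkQ _).comp ρ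
    have hτs : Function.Surjective τ :=
      (Submodule.mkQ_surjective _).comp (LinearMap.range_eq_top.mp hρ)
    have hτk : LinearMap.ker τ = T.projRad j := by
      ext y
      rw [LinearMap.mem_ker, LinearMap.comp_apply, Submodule.mkQ_apply,
        Submodule.Quotient.mk_eq_zero, Submodule.submoduleOf, Submodule.mem_comap]
      change φ y ∈ Submodule.map φ (T.projRad j) ↔ _
      rw [← Submodule.mem_comap, Submodule.comap_map_eq, sup_eq_left.mpr hker]
    let g : simpleMod T.idem j ≃ₗ[A] W ⧸ U.submoduleOf W :=
      (Submodule.quotEquivOfEq _ _ ((T.jacobson_projMod j).trans hτk.symm)).trans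
        (τ.quotKerEquivOfSurjective hτs)
    refine ⟨U, W, ?_, ⟨g.symm⟩⟩
    have hUW : U ≤ W := LinearMap.map_le_range
    have hco : IsCoatom (U.submoduleOf W) := by
      rw [← isSimpleModule_iff_isCoatom]
      have : IsSimpleModule A (simpleMod T.idem j) := by
        rw [isSimpleModule_iff_isCoatom, T.jacobson_projMod]
        exact T.isCoatom_projRad j
      exact IsSimpleModule.congr g.symm
    rw [covBy_iff_quot_is_simple hUW]
    rwa [isSimpleModule_iff_isCoatom]

/-- Having no composition factor `L_j` means being killed by `e_j`, which turns the definition into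
a condition on elements. -/
theorem stdKer_eq (i : Fin n) : stdKer T.idem i = sInf {U : Submodule A (projMod T.idem i) |
    ∀ j, i < j → ∀ x, T.idem j • x ∈ U} := by
  unfold stdKer
  congr 1
  ext U
  simp only [Set.mem_ofPred_eq, T.isCompositionFactor_iff, not_exists, not_not]
  refine forall₂_congr fun j _ => ⟨fun h x => ?_, fun h x => ?_⟩
  · rw [← Submodule.Quotient.mk_eq_zero, Submodule.Quotient.mk_smul]
    exact h _
  · obtain ⟨x, rfl⟩ := Submodule.Quotient.mk_surjective _ x
    rw [← Submodule.Quotient.mk_smul, Submodule.Quotient.mk_eq_zero]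
    exact h _

theorem projElt_mem_stdKer {i m : Fin n} (h : i < m) : T.projElt m i ∈ stdKer T.idem i := by
  rw [T.stdKer_eq, Submodule.mem_sInf]
  intro U hU
  have h1 := hU m h (T.projElt m i)
  have h2 : T.idem m • T.projElt m i = T.projElt m i := Subtype.ext (T.elt_self_mul m i)
  rwa [h2] at h1

/-- The radical is one of the submodules in the intersection, since the character of `i` kills `e_j`
for `j ≠ i`. This lets the character descend to `Δ_i`. -/
theorem stdKer_le_projRad (i : Fin n) : stdKer T.idem i ≤ T.projRad i := by
  rw [T.stdKer_eq]
  refine sInf_le fun j hj x => ?_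
  rw [mem_projRad]
  change T.char i (T.idem j * x) = 0
  rw [map_mul, T.char_apply i (T.idem j), T.coeff_elt_of_ne fun h => hj.ne h.1, zero_mul]

/-- `e_j Δ_i = 0` if and only if the basis element `i → j` vanishes or factors through some
`m > i`. -/
theorem idem_smul_stdMod_eq_zero_iff {i j : Fin n} (h0 : T.elt j i ≠ 0) :
    (∀ x : stdMod T.idem i, T.idem j • x = 0) ↔ ∃ m, i < m ∧ T.Through j m i := by
  constructor
  · intro h
    by_contra! hm
    -- The span of the basis elements that factor through some `m > i`; it is stable under left
    -- multiplication by `Through.trans` and contains `stdKer`.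
    let U : Submodule A (projMod T.idem i) :=
      { carrier := {x | ∀ l, (∀ m, i < m → ¬ T.Through l m i) → T.coeff l i x = 0}
        add_mem' := fun {x y} hx hy l hl => by simp [hx l hl, hy l hl]
        zero_mem' := fun l _ => by simp
        smul_mem' := fun a x hx l hl => by
          by_contra h1
          obtain ⟨m, hlm, -, h2⟩ := T.exists_of_coeff_mul_ne_zero (x := a) (y := x) h1
          refine h2 (hx m fun m' hm' h3 => hl m' hm' (hlm.trans h3).1) }
    have hU : stdKer T.idem i ≤ U := by
      rw [T.stdKer_eq]
      refine sInf_le fun j' hj' x l hl => ?_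
      by_contra h1
      obtain ⟨m, hlm, h2, h3⟩ := T.exists_of_coeff_mul_ne_zero (x := T.idem j') (y := x) h1
      have h4 : l = j' := by
        by_contra h5
        exact h2 (T.coeff_elt_of_ne fun h6 => h5 h6.1)
      subst h4
      exact hl l hj' (T.through_left hlm.ne_zero)
    have h1 := h (Submodule.Quotient.mk (T.projElt j i))
    rw [← Submodule.Quotient.mk_smul, Submodule.Quotient.mk_eq_zero] at h1
    have h2 := hU h1 j hm
    change T.coeff j i (T.idem j * T.elt j i) = 0 at h2
    rw [T.elt_self_mul, T.coeff_elt_self h0] at h2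
    exact one_ne_zero h2
  · rintro ⟨m, him, hm⟩ x
    obtain ⟨x, rfl⟩ := Submodule.Quotient.mk_surjective _ x
    rw [← Submodule.Quotient.mk_smul, Submodule.Quotient.mk_eq_zero, T.idem_smul]
    refine Submodule.smul_mem _ _ ?_
    have : T.projElt j i = T.elt j m • T.projElt m i := Subtype.ext hm.mul_eq.symm
    rw [this]
    exact Submodule.smul_mem _ _ (T.projElt_mem_stdKer him)

/-- The functional is the projection of `Δ_i` onto its top; it allows the modules `S_i` to be
recognized by characters of `A`. -/
theorem exists_stdMod_char (i : Fin n) : ∃ ψ : stdMod T.idem i →+ k,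
    (∀ (a : A) (x : stdMod T.idem i), ψ (a • x) = T.char i a * ψ x) ∧ ψ ≠ 0 := by
  refine ⟨QuotientAddGroup.lift _
    ((T.char i : A →+ k).comp (Submodule.subtype (Submodule.span A {T.idem i})).toAddMonoidHom)
    fun x hx => T.stdKer_le_projRad i hx, ?_, ?_⟩
  · intro a x
    obtain ⟨x, rfl⟩ := Submodule.Quotient.mk_surjective _ x
    exact map_mul (T.char i) a x
  · intro h
    have h1 := DFunLike.congr_fun h (Submodule.Quotient.mk (T.projElt i i))
    exact one_ne_zero ((T.char_elt_self i).symm.trans h1)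

end ThinBasis

/-! ### Elements and homomorphisms of induced modules. -/

namespace Induced

variable {k : Type u} {A : Type w} [Field k] [Ring A] [Algebra k A] (B : Subalgebra k A)
  {M : Type w} [AddCommGroup M] [Module B M]

/-- The class of `a ⊗ x` in `A ⊗_B M`. -/
def tmul (a : A) (x : M) : Induced B M := Submodule.Quotient.mk (a ⊗ₜ[ℤ] x)

theorem smul_tmul (a a' : A) (x : M) : a • tmul B a' x = tmul B (a * a') x := by
  rw [tmul, tmul, ← Submodule.Quotient.mk_smul, TensorProduct.smul_tmul', smul_eq_mul]

theorem tmul_add (a : A) (x y : M) : tmul B a (x + y) = tmul B a x + tmul B a y := by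
  rw [tmul, TensorProduct.tmul_add, Submodule.Quotient.mk_add]; rfl

theorem tmul_zero (a : A) : tmul B a (0 : M) = 0 := by
  rw [tmul, TensorProduct.tmul_zero, Submodule.Quotient.mk_zero]

theorem tmul_smul (a : A) (b : B) (x : M) : tmul B a (b • x) = tmul B (a * b) x := by
  refine ((Submodule.Quotient.eq _).mpr ?_).symm
  exact Submodule.subset_span ⟨a, b, x, rfl⟩

theorem hom_ext {N : Type*} [AddCommGroup N] {f g : Induced B M →+ N}
    (h : ∀ a x, f (tmul B a x) = g (tmul B a x)) : f = g := by
  ext t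
  obtain ⟨t, rfl⟩ := Submodule.Quotient.mk_surjective _ t
  induction t with
  | zero => rw [Submodule.Quotient.mk_zero, map_zero, map_zero]
  | tmul a x => exact h a x
  | add s t hs ht => rw [Submodule.Quotient.mk_add, map_add, map_add, hs, ht]

theorem inducedMap_tmul {N : Type w} [AddCommGroup N] [Module B N] (f : M →ₗ[B] N) (a : A)
    (x : M) : inducedMap B f (tmul B a x) = tmul B a (f x) := rfl

/-- The left ideal of `A` generated by the kernel of a character of `B`. -/
def charIdeal (χ : A →ₐ[k] k) : Submodule A A := Submodule.span A {b | b ∈ B ∧ χ b = 0}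

/-- An additive map `c : M → k` which is semilinear with respect to a character induces a
homomorphism from `A ⊗_B M` to the module induced from that character. -/
theorem exists_liftChar (χ : A →ₐ[k] k) (c : M →+ k)
    (hc : ∀ (b : B) (x : M), c (b • x) = χ b * c x) :
    ∃ Φ : Induced B M →ₗ[A] A ⧸ charIdeal B χ,
      ∀ a x, Φ (tmul B a x) = Submodule.Quotient.mk (c x • a) := by
  let f : A →ₗ[A] M →ₗ[ℤ] A ⧸ charIdeal B χ :=
    LinearMap.mk₂' A ℤ (fun a x => Submodule.Quotient.mk (c x • a))
      (fun a a' x => by rw [smul_add, Submodule.Quotient.mk_add])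
      (fun a a' x => by rw [← Submodule.Quotient.mk_smul, smul_eq_mul, smul_eq_mul, mul_smul_comm])
      (fun a x y => by rw [map_add, add_smul, Submodule.Quotient.mk_add])
      (fun z a x => by rw [map_zsmul, smul_assoc]; rfl)
  refine ⟨Submodule.liftQ _ (TensorProduct.AlgebraTensorModule.lift f) ?_, fun a x => rfl⟩
  rw [balancedRel, Submodule.span_le]
  rintro _ ⟨a, b, x, rfl⟩
  rw [SetLike.mem_coe, LinearMap.mem_ker, map_sub, sub_eq_zero]
  refine (Submodule.Quotient.eq _).mpr ?_
  rw [hc]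
  -- The defect of balancedness is a left multiple of `b - χ(b)`, a generator of `charIdeal`.
  have h : c x • (a * (b : A)) - (χ b * c x) • a =
      (c x • a) • ((b : A) - algebraMap k A (χ b)) := by
    rw [smul_eq_mul, mul_sub, ← Algebra.commutes, ← Algebra.smul_def, smul_smul, smul_mul_assoc]
  rw [h]
  refine Submodule.smul_mem _ _ (Submodule.subset_span ⟨?_, ?_⟩)
  · exact B.sub_mem b.2 (B.algebraMap_mem _)
  · simp

end Induced

/-! ### Simple modules determined by characters. -/

section SimpleModules

variable {R : Type w} [Ring R] {k : Type u} [Field k] (χ : R →+* k)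
  {S S' : Type w} [AddCommGroup S] [Module R S] [AddCommGroup S'] [Module R S']
  [IsSimpleModule R S] [IsSimpleModule R S'] {ψ : S →+ k} {ψ' : S' →+ k}

/-- A nonzero functional on a simple module which is semilinear for a character is injective. -/
theorem injective_of_char (hψ : ∀ b x, ψ (b • x) = χ b * ψ x) (h0 : ψ ≠ 0) :
    Function.Injective ψ := by
  obtain ⟨s, hs⟩ := DFunLike.ne_iff.mp h0
  let K : Submodule R S :=
    { ψ.ker with
      smul_mem' := fun a x hx => by
        have hx : ψ x = 0 := hx
        change ψ (a • x) = 0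
        rw [hψ, hx, mul_zero] }
  have hK : K = ⊥ := (eq_bot_or_eq_top K).resolve_right fun h =>
    hs (show s ∈ K from h ▸ Submodule.mem_top)
  refine (injective_iff_map_eq_zero ψ).mpr fun x hx => ?_
  rw [← Submodule.mem_bot R, ← hK]
  exact hx

/-- The functional is injective, so the annihilator of any nonzero element of `S` is the kernel of
the character. -/
theorem nonempty_quot_ker_equiv_of_char (hψ : ∀ b x, ψ (b • x) = χ b * ψ x) (h0 : ψ ≠ 0) :
    Nonempty ((R ⧸ (RingHom.ker χ : Ideal R)) ≃ₗ[R] S) := by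
  obtain ⟨s, hs⟩ := DFunLike.ne_iff.mp h0
  have hs0 : s ≠ 0 := fun h => hs (by simp [h])
  refine ⟨(Submodule.quotEquivOfEq _ _ ?_).trans ((LinearMap.toSpanSingleton R S
    s).quotKerEquivOfSurjective (IsSimpleModule.toSpanSingleton_surjective R hs0))⟩
  ext b
  rw [RingHom.mem_ker, LinearMap.mem_ker, LinearMap.toSpanSingleton_apply,
    ← map_eq_zero_iff ψ (injective_of_char χ hψ h0), hψ, mul_eq_zero, or_iff_left (show ψ s ≠ 0 from hs)]

/-- Simple modules with a nonzero semilinear functional for the same character are isomorphic. -/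
theorem nonempty_linearEquiv_of_char (hψ : ∀ b x, ψ (b • x) = χ b * ψ x)
    (hψ' : ∀ b x, ψ' (b • x) = χ b * ψ' x) (h0 : ψ ≠ 0) (h0' : ψ' ≠ 0) :
    Nonempty (S ≃ₗ[R] S') := by
  obtain ⟨g⟩ := nonempty_quot_ker_equiv_of_char χ hψ h0
  obtain ⟨g'⟩ := nonempty_quot_ker_equiv_of_char χ hψ' h0'
  exact ⟨g.symm.trans g'⟩

end SimpleModules

/-! ### Subalgebras that contain the idempotents, and the exactness of induction. -/

namespace ThinBasis

variable {k : Type u} {A : Type w} {V : Type*} [Field k] [Ring A] [Algebra k A] [Fintype V]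
  (T : ThinBasis k A V) (B : Subalgebra k A)

/-- If `B` separates the characters of `A`, then it contains a conjugate of each of the
idempotents `elt i i`. -/
theorem exists_conj_idem_mem (hB : ∀ i j, i ≠ j → ∃ b ∈ B, T.char i b ≠ T.char j b) :
    ∃ a : Aˣ, ∀ i, (T.conj a).elt i i ∈ B := by
  classical
  -- As in Lagrange interpolation, the required element is a product of normalized separating
  -- elements.
  have hsep : ∀ i (s : Finset V), i ∉ s →
      ∃ b : B, T.char i b = 1 ∧ ∀ j ∈ s, T.char j b = 0 := by
    intro i s
    induction s using Finset.induction_on with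
    | empty => exact fun _ => ⟨1, by simp, by simp⟩
    | insert j s _ ih =>
      intro hi
      rw [Finset.mem_insert, not_or] at hi
      obtain ⟨b, hb1, hb0⟩ := ih hi.2
      obtain ⟨c, hc, hne⟩ := hB i j hi.1
      refine ⟨b * ((T.char i c - T.char j c)⁻¹ • (⟨c, hc⟩ - algebraMap k B (T.char j c))), ?_, ?_⟩
      · simp [hb1, inv_mul_cancel₀ (sub_ne_zero.mpr hne)]
      · intro l hl
        rcases Finset.mem_insert.mp hl with rfl | hl
        · simp
        · simp [hb0 l hl]
  -- The kernel of `F` is nil and the coordinate idempotents lie in its range, so they lift to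
  -- orthogonal idempotents of `B`.
  let F : B →+* (V → k) := RingHom.pi fun i => ((T.char i).comp B.val).toRingHom
  have hF : ∀ b i, F b i = T.char i (b : A) := fun _ _ => rfl
  obtain ⟨f, hf, hfe⟩ := CompleteOrthogonalIdempotents.lift_of_isNilpotent_ker F
    (fun x hx => by
      obtain ⟨N, hN⟩ := T.isNilpotent_of_char_eq_zero (x := (x : A)) fun i =>
        congrFun (RingHom.mem_ker.mp hx) i
      exact ⟨N, Subtype.ext (by simpa using hN)⟩)
    (CompleteOrthogonalIdempotents.single fun _ : V => k) (fun i => by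
      obtain ⟨b, hb1, hb0⟩ := hsep i (Finset.univ.erase i) (by simp)
      refine ⟨b, funext fun j => ?_⟩
      rw [hF]
      by_cases hj : j = i
      · subst hj; rw [hb1, Pi.single_eq_same]
      · rw [hb0 j (by simp [hj]), Pi.single_eq_of_ne hj])
  have hchar : ∀ i j, T.char j (f i : A) = if j = i then 1 else 0 := by
    intro i j
    rw [← hF, ← Pi.single_apply]
    exact congrFun (congrFun hfe i) j
  -- This `y` intertwines the two families, `f_i y = f_i e_i = y e_i`, and is a unit because all
  -- characters take the value one at it.
  let y : A := ∑ i, (f i : A) * T.elt i i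
  have hy : IsUnit y := by
    have h := (T.isNilpotent_of_char_eq_zero (x := y - 1) fun j => by
      rw [map_sub, map_one, map_sum, Finset.sum_eq_single j]
      · rw [map_mul, hchar, T.char_elt_self]; simp
      · intro i _ hij
        rw [map_mul, hchar, if_neg hij.symm, zero_mul]
      · simp).isUnit_add_one
    rwa [sub_add_cancel] at h
  obtain ⟨a, ha⟩ := hy
  refine ⟨a, fun i => ?_⟩
  have h1 : (f i : A) * a = a * T.elt i i := by
    rw [ha, Finset.mul_sum, Finset.sum_mul, Finset.sum_eq_single i, Finset.sum_eq_single i]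
    · rw [← mul_assoc, mul_assoc (f i : A) (T.elt i i), T.elt_self_mul]
      congr 1
      exact congrArg Subtype.val (hf.idem i)
    · intro j _ hj
      rw [mul_assoc, T.mul_of_ne hj, mul_zero]
    · simp
    · intro j _ hj
      rw [← mul_assoc]
      have : (f i : A) * f j = 0 := congrArg Subtype.val (hf.ortho hj.symm)
      rw [this, zero_mul]
    · simp
  rw [conj_elt, ← h1, Units.mul_inv_cancel_right]
  exact (f i).2

variable {B}

theorem coeff_smul_elt_mem (hB : ∀ i, T.elt i i ∈ B) {b : A} (hb : b ∈ B) (j i : V) :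
    T.coeff j i b • T.elt j i ∈ B := by
  rw [← T.elt_mul_mul_elt]
  exact B.mul_mem (B.mul_mem (hB j) hb) (hB i)

theorem elt_mem_of_coeff (hB : ∀ i, T.elt i i ∈ B) {b : A} (hb : b ∈ B) {j i : V}
    (h : T.coeff j i b ≠ 0) : T.elt j i ∈ B := by
  have := B.smul_mem (T.coeff_smul_elt_mem hB hb j i) (T.coeff j i b)⁻¹
  rwa [smul_smul, inv_mul_cancel₀ h, one_smul] at this

/-- A basis element `i → j` in the left ideal generated by the elements of `B` killed by the
character of `i` factors through a basis element in `B`. -/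
theorem exists_through_of_mem_charIdeal (hB : ∀ i, T.elt i i ∈ B) {j i : V} {x : A}
    (hx : x ∈ Induced.charIdeal B (T.char i)) (h : T.coeff j i x ≠ 0) :
    ∃ m, m ≠ i ∧ T.elt m i ∈ B ∧ T.Through j m i := by
  induction hx using Submodule.span_induction generalizing j with
  | mem b hb =>
    refine ⟨j, ?_, T.elt_mem_of_coeff hB hb.1 h, T.through_left (T.elt_ne_zero_of_coeff h)⟩
    rintro rfl
    exact h hb.2
  | zero => exact absurd (map_zero _) h
  | add x y _ _ hx hy =>
    by_cases h0 : T.coeff j i x = 0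
    · rw [map_add, h0, zero_add] at h; exact hy h
    · exact hx h0
  | smul a x _ hx =>
    obtain ⟨l, hl, -, h2⟩ := T.exists_of_coeff_mul_ne_zero (x := a) (y := x) h
    obtain ⟨m, hmi, hmB, hm⟩ := hx h2
    exact ⟨m, hmi, hmB, (hl.trans hm).1⟩

/-- This is the counterpart for `A ⊗_B S` of `idem_smul_stdMod_eq_zero_iff`. If `e_j` kills the
module, then `elt j i ⊗ s = 0` puts `elt j i` into `charIdeal`. Conversely, a factor `elt m i` in
`B` slides across the tensor sign and kills `S`. -/
theorem induced_char_iff (hB : ∀ i, T.elt i i ∈ B) {S : Type w} [AddCommGroup S] [Module B S]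
    [IsSimpleModule B S] {i j : V} (h0 : T.elt j i ≠ 0) {ψ : S →+ k}
    (hψ : ∀ (b : B) x, ψ (b • x) = T.char i b * ψ x) (hψ0 : ψ ≠ 0) :
    (∀ x : Induced B S, T.elt j j • x = 0) ↔
      ∃ m, m ≠ i ∧ T.elt m i ∈ B ∧ T.Through j m i := by
  obtain ⟨s, hs⟩ := DFunLike.ne_iff.mp hψ0
  constructor
  · intro h
    obtain ⟨Φ, hΦ⟩ := Induced.exists_liftChar B (T.char i) ψ hψ
    have h1 := congrArg Φ (h (Induced.tmul B (T.elt j i) s))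
    rw [Induced.smul_tmul, T.elt_self_mul, hΦ, map_zero, Submodule.Quotient.mk_eq_zero] at h1
    refine T.exists_through_of_mem_charIdeal hB h1 (j := j) ?_
    rwa [map_smul, T.coeff_elt_self h0, smul_eq_mul, mul_one]
  · rintro ⟨m, hmi, hmB, hm⟩
    have hinj := (injective_iff_map_eq_zero ψ).mp
      (injective_of_char ((T.char i).comp B.val).toRingHom hψ hψ0)
    have hidem : ∀ x : S, (⟨T.elt i i, hB i⟩ : B) • x = x := fun x => by
      rw [← sub_eq_zero]
      exact hinj _ (by rw [map_sub, hψ, T.char_elt_self, one_mul, sub_self])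
    have hkill : ∀ x : S, (⟨T.elt m i, hmB⟩ : B) • x = 0 := fun x =>
      hinj _ (by rw [hψ, T.char_elt_of_ne hmi, zero_mul])
    have h1 : DistribSMul.toAddMonoidHom (Induced B S) (T.elt j j) = 0 := by
      refine Induced.hom_ext B fun a x => ?_
      change T.elt j j • Induced.tmul B a x = 0
      rw [Induced.smul_tmul, ← hidem x, Induced.tmul_smul, T.elt_mul_mul_elt, ← hm.mul_eq,
        ← smul_mul_assoc, ← Induced.tmul_smul B _ ⟨T.elt m i, hmB⟩, hkill, Induced.tmul_zero]
    exact fun x => DFunLike.congr_fun h1 x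

/-- Exactness of induction applied to the inclusion of the left ideal of `B` generated by two
basis elements. -/
theorem exists_through_of_inductionExact (hB : ∀ i, T.elt i i ∈ B) (hex : InductionExact B)
    {i j m : V} (hj : T.elt j i ∈ B) (hm : T.elt m i ∈ B) (h : T.Through j m i) (hjm : j ≠ m) :
    ∃ m', m' ≠ m ∧ T.elt m' m ∈ B ∧ T.Through j m' m := by
  let x : B := ⟨T.elt m i, hm⟩
  let y : B := ⟨T.elt j i, hj⟩
  let J : Submodule B B := Submodule.span B {x, y}
  have hfin : Module.Finite B J := Module.Finite.iff_fg.mpr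
    (Submodule.fg_span (Set.toFinite _))
  have hxJ : x ∈ J := Submodule.subset_span (Set.mem_insert _ _)
  have hyJ : y ∈ J := Submodule.subset_span (Set.mem_insert_of_mem _ rfl)
  -- In column `i`, elements of `J` live at `m` or at greater height. Hence the coefficient of `elt
  -- m i` is semilinear on `J` for the character of `m`.
  have hsupp : ∀ b ∈ J, ∀ l, T.coeff l i (b : A) ≠ 0 → l = m ∨ T.height m < T.height l := by
    intro b hb
    induction hb using Submodule.span_induction with
    | mem b hb =>
      intro l hl
      rcases hb with rfl | rfl
      · left
        by_contra h1
        exact hl (T.coeff_elt_of_ne fun h2 => h1 h2.1)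
      · right
        have : l = j := by
          by_contra h1
          exact hl (T.coeff_elt_of_ne fun h2 => h1 h2.1)
        subst this
        exact T.height_lt h.left hjm
    | zero => exact fun l hl => absurd (map_zero _) hl
    | add b c _ _ hb hc =>
      intro l hl
      by_cases h0 : T.coeff l i (b : A) = 0
      · refine hc l fun h1 => hl ?_
        change T.coeff l i ((b : A) + c) = 0
        rw [map_add, h0, h1, zero_add]
      · exact hb l h0
    | smul a b _ hb =>
      intro l hl
      obtain ⟨r, hr, -, h2⟩ := T.exists_of_coeff_mul_ne_zero (x := (a : A)) (y := b) hl
      by_cases hlr : l = r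
      · exact hlr ▸ hb r h2
      · have := T.height_lt hr.left hlr
        rcases hb r h2 with rfl | h3
        · exact Or.inr this
        · exact Or.inr (h3.trans this)
  let c : J →+ k := ((T.coeff m i).toAddMonoidHom.comp B.val.toLinearMap.toAddMonoidHom).comp
    J.subtype.toAddMonoidHom
  have hc : ∀ (b : B) (z : J), c (b • z) = T.char m b * c z := by
    intro b z
    refine T.coeff_mul_of_unique (b : A) (z : B) m (T.through_left h.right) fun l hl _ h2 => ?_
    rcases hsupp z z.2 l h2 with h3 | h3
    · exact h3
    · by_contra h4
      exact lt_asymm h3 (T.height_lt hl.left (Ne.symm h4))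
  obtain ⟨hinj, -, -⟩ := hex J B (B ⧸ J) J.subtype J.mkQ J.subtype_injective
    (LinearMap.exact_subtype_mkQ J) J.mkQ_surjective
  -- Both tensors become `elt j i ⊗ 1` in `A ⊗_B B`, and the induced inclusion of `J` is injective.
  have heq : Induced.tmul B (T.elt j m) (⟨x, hxJ⟩ : J) = Induced.tmul B 1 (⟨y, hyJ⟩ : J) := by
    apply hinj
    rw [Induced.inducedMap_tmul, Induced.inducedMap_tmul, J.subtype_apply, J.subtype_apply]
    have hone : ∀ (a : A) (b : B), Induced.tmul B a b = Induced.tmul B (a * b) (1 : B) := by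
      intro a b
      rw [← Induced.tmul_smul, smul_eq_mul, mul_one]
    rw [hone, hone 1]
    congr 1
    rw [one_mul]
    exact h.mul_eq
  obtain ⟨Φ, hΦ⟩ := Induced.exists_liftChar B (T.char m) c hc
  have h1 := congrArg Φ heq
  rw [hΦ, hΦ, Submodule.Quotient.eq] at h1
  have hcx : c ⟨x, hxJ⟩ = 1 := T.coeff_elt_self h.right
  have hcy : c ⟨y, hyJ⟩ = 0 := T.coeff_elt_of_ne fun h2 => hjm h2.1.symm
  -- The functional is one at `x` and zero at `y`, so `elt j m` itself lies in `charIdeal`.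
  rw [hcx, hcy, one_smul, zero_smul, sub_zero] at h1
  refine T.exists_through_of_mem_charIdeal hB h1 ?_
  rw [T.coeff_elt_self h.left]
  exact one_ne_zero

end ThinBasis

/-! ### Minimal basis elements and the conjugacy theorem. -/

namespace ThinBasis

variable {k : Type u} {A : Type w} [Field k] [Ring A] [Algebra k A] {n : ℕ}
  (T : ThinBasis k A (Fin n))

/-- The basis element `i → j` is nonzero with `i < j` and factors through no other `m > i`. -/
def Minimal (j i : Fin n) : Prop :=
  T.elt j i ≠ 0 ∧ i < j ∧ ∀ m, i < m → T.Through j m i → m = j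

/-- The subalgebra generated by the idempotents and the minimal basis elements. -/
def minSubalgebra : Subalgebra k A :=
  Algebra.adjoin k {x | ∃ j i, (j = i ∨ T.Minimal j i) ∧ x = T.elt j i}

theorem idem_mem_minSubalgebra (i : Fin n) : T.elt i i ∈ T.minSubalgebra :=
  Algebra.subset_adjoin ⟨i, i, Or.inl rfl, rfl⟩

variable {T} in
theorem Minimal.elt_mem {j i : Fin n} (h : T.Minimal j i) : T.elt j i ∈ T.minSubalgebra :=
  Algebra.subset_adjoin ⟨j, i, Or.inr h, rfl⟩

/-- If `i → j` factors through some `m > i`, then it factors through the target of a minimal basis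
element starting at `i`. -/
theorem exists_minimal {j i m : Fin n} (him : i < m) (hm : T.Through j m i) :
    ∃ m', T.Minimal m' i ∧ T.Through j m' i := by
  induction hh : T.height m using Nat.strong_induction_on generalizing m with
  | _ N ih =>
    by_cases hmin : ∀ m', i < m' → T.Through m m' i → m' = m
    · exact ⟨m, ⟨hm.right, him, hmin⟩, hm⟩
    · push Not at hmin
      obtain ⟨m', him', hm', hne⟩ := hmin
      exact ih _ (hh ▸ T.height_lt hm'.left hne.symm) him' (hm.trans hm').1 rfl

/-- A relation on the vertices which determines a subalgebra with the induction properties of an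
exact Borel subalgebra is that of the subalgebra of minimal basis elements. -/
theorem elt_mem_minSubalgebra {R : Fin n → Fin n → Prop}
    (hmul : ∀ j m i, R j m → R m i → T.Through j m i → R j i)
    (hmin : ∀ {j i}, T.Minimal j i → R j i)
    (hstd : ∀ j i, (∃ m, m ≠ i ∧ R m i ∧ T.Through j m i) → ∃ m, i < m ∧ T.Through j m i)
    (hex : ∀ j m i, R j i → R m i → T.Through j m i → j ≠ m →
      ∃ m', m' ≠ m ∧ R m' m ∧ T.Through j m' m)
    {j m i : Fin n} (hj : R j i) (hm : R m i) (hmem : T.elt m i ∈ T.minSubalgebra)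
    (hthr : T.Through j m i) : T.elt j i ∈ T.minSubalgebra := by
  induction hh : T.height j - T.height m using Nat.strong_induction_on generalizing m with
  | _ N ih =>
    by_cases hjm : j = m
    · exact hjm ▸ hmem
    -- The remainder `m → j` passes through a vertex above `m`, hence begins with a minimal element
    -- `m → m₂`; then `m₂` replaces `m`.
    obtain ⟨m₁, hlt, hm₁⟩ := hstd j m (hex j m i hj hm hthr hjm)
    obtain ⟨m₂, hmin₂, hm₂⟩ := T.exists_minimal hlt hm₁
    obtain ⟨h1, h2⟩ := hthr.trans' hm₂
    have hheight := T.height_lt hmin₂.1 hmin₂.2.1.ne'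
    -- The truncated difference of heights drops only because `m` lies strictly below `j` in height.
    have hheight' := T.height_lt hthr.left hjm
    refine ih _ ?_ (hmul _ _ _ (hmin hmin₂) hm h2) ?_ h1 rfl
    · omega
    · rw [← h2.mul_eq]
      exact T.minSubalgebra.mul_mem hmin₂.elt_mem hmem

/-- The functional of `Δ_i` is pulled back along `x ↦ 1 ⊗ x`; it stays nonzero because the elements
`1 ⊗ x` generate the induced module over `A`. -/
theorem exists_char_of_induced {B : Subalgebra k A} {S : Type w} [AddCommGroup S] [Module B S]
    {i : Fin n} (g : Induced B S ≃ₗ[A] stdMod T.idem i) :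
    ∃ ψ : S →+ k, (∀ (b : B) (x : S), ψ (b • x) = T.char i b * ψ x) ∧ ψ ≠ 0 := by
  obtain ⟨ψ, hψ, hψ0⟩ := T.exists_stdMod_char i
  refine ⟨AddMonoidHom.mk' (fun x => ψ (g (Induced.tmul B 1 x))) fun x y => ?_, fun b x => ?_,
    fun h => hψ0 ?_⟩
  · rw [Induced.tmul_add, map_add, map_add]
  · change ψ (g (Induced.tmul B 1 (b • x))) = T.char i b * ψ (g (Induced.tmul B 1 x))
    rw [Induced.tmul_smul, one_mul, ← hψ, ← map_smul, Induced.smul_tmul, mul_one]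
  · have h1 : ψ.comp (g : Induced B S →+ stdMod T.idem i) = 0 := by
      refine Induced.hom_ext B fun a x => ?_
      have h2 : ψ (g (Induced.tmul B 1 x)) = 0 := DFunLike.congr_fun h x
      change ψ (g (Induced.tmul B a x)) = 0
      rw [← mul_one a, ← Induced.smul_tmul, map_smul, hψ, h2, mul_zero]
    ext y
    have := DFunLike.congr_fun h1 (g.symm y)
    simpa using this

/-- An exact Borel subalgebra is conjugate to the subalgebra of minimal basis elements. -/
theorem exists_conj_of_isExactBorel {B : Subalgebra k A} (hB : IsExactBorel k T.idem B) :
    ∃ a : Aˣ, (B : Set A) = {x | ∃ b ∈ T.minSubalgebra, x = (a : A) * b * (↑a⁻¹)} := by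
  obtain ⟨hex, S, hS, hiso, -, hind, -, -⟩ := hB
  have g := fun i => (hind i).some
  choose ψ hψ hψ0 using fun i => T.exists_char_of_induced (g i)
  -- If two characters agreed on `B`, the corresponding simple modules would be isomorphic.
  obtain ⟨a, ha⟩ := T.exists_conj_idem_mem B fun i j hij => by
    by_contra! h
    refine hij (hiso i j ?_)
    have := hS i
    have := hS j
    exact nonempty_linearEquiv_of_char ((T.char i).comp B.val).toRingHom (hψ i)
      (fun b x => (hψ j b x).trans (by rw [← h b b.2]; rfl)) (hψ0 i) (hψ0 j)
  have hstd : ∀ {j i}, T.elt j i ≠ 0 → ((∃ m, i < m ∧ T.Through j m i) ↔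
      ∃ m, m ≠ i ∧ (T.conj a).elt m i ∈ B ∧ T.Through j m i) := by
    intro j i h0
    have := hS i
    have h := (T.conj a).induced_char_iff ha (i := i) (j := j) (mt (T.conj_elt_eq_zero a).mp h0)
      (fun b x => (hψ i b x).trans (by rw [T.conj_char])) (hψ0 i)
    simp only [T.conj_through] at h
    rw [← h, ← T.idem_smul_stdMod_eq_zero_iff h0, (g i).symm.surjective.forall]
    -- It remains to see that `e_j` and its conjugate by a unit annihilate the same modules.
    simp only [← map_smul, map_eq_zero_iff _ (g i).symm.injective, T.conj_elt]
    constructor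
    · intro h x
      rw [mul_assoc, mul_smul, mul_smul, h, smul_zero]
    · intro h x
      have h1 := h ((a : A) • x)
      rwa [← mul_smul, Units.inv_mul_cancel_right, mul_smul, ← Units.smul_def,
        smul_eq_zero_iff_eq] at h1
  have hmul : ∀ j m i, (T.conj a).elt j m ∈ B → (T.conj a).elt m i ∈ B → T.Through j m i →
      (T.conj a).elt j i ∈ B := by
    intro j m i h1 h2 h
    rw [← ((T.conj_through a).mpr h).mul_eq]
    exact B.mul_mem h1 h2
  have hmin : ∀ {j i}, T.Minimal j i → (T.conj a).elt j i ∈ B := by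
    intro j i h
    obtain ⟨m, hmi, hmB, hm⟩ := (hstd h.1).mp ⟨j, h.2.1, T.through_left h.1⟩
    obtain ⟨m', him', hm'⟩ := (hstd hm.right).mpr ⟨m, hmi, hmB, T.through_left hm.right⟩
    -- Minimality forces `m' = j`; now `j` and `m` are joined by nonzero basis elements in both
    -- directions, so they coincide.
    have h1 := h.2.2 m' him' (hm.trans hm').1
    subst h1
    exact T.eq_of_ne_zero hm.left hm'.left ▸ hmB
  have hmem : ∀ {j i}, T.elt j i ≠ 0 → (T.conj a).elt j i ∈ B → T.elt j i ∈ T.minSubalgebra := by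
    intro j i h0 h
    refine T.elt_mem_minSubalgebra (R := fun j i => (T.conj a).elt j i ∈ B) hmul hmin ?_ ?_ h
      (ha i) (T.idem_mem_minSubalgebra i) (T.through_right h0)
    · rintro j i ⟨m, hmi, hmB, hm⟩
      exact (hstd hm.ne_zero).mpr ⟨m, hmi, hmB, hm⟩
    · intro j m i hj hm h hjm
      obtain ⟨m', h1, h2, h3⟩ := (T.conj a).exists_through_of_inductionExact ha hex hj hm
        ((T.conj_through a).mpr h) hjm
      exact ⟨m', h1, h2, (T.conj_through a).mp h3⟩
  refine ⟨a, Set.ext fun x => ⟨fun hx => ?_, ?_⟩⟩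
  · refine ⟨∑ j, ∑ i, (T.conj a).coeff j i x • T.elt j i, ?_, ?_⟩
    · refine sum_mem fun j _ => sum_mem fun i _ => ?_
      by_cases h0 : (T.conj a).coeff j i x = 0
      · rw [h0, zero_smul]; exact zero_mem _
      · refine Subalgebra.smul_mem _ (hmem ?_ ((T.conj a).elt_mem_of_coeff ha hx h0)) _
        exact mt (T.conj_elt_eq_zero a).mpr ((T.conj a).elt_ne_zero_of_coeff h0)
    · conv_lhs => rw [(T.conj a).eq_sum x]
      simp only [Finset.mul_sum, Finset.sum_mul, mul_smul_comm, smul_mul_assoc, T.conj_elt]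
  · rintro ⟨b, hb, rfl⟩
    induction hb using Algebra.adjoin_induction with
    | mem b hb =>
      obtain ⟨j, i, rfl | h, rfl⟩ := hb
      · exact ha j
      · exact hmin h
    | algebraMap r =>
      rw [← Algebra.commutes, mul_assoc, Units.mul_inv, mul_one]
      exact B.algebraMap_mem r
    | add x y _ _ hx hy =>
      rw [mul_add, add_mul]
      exact B.add_mem hx hy
    | mul x y _ _ hx hy =>
      have : (a : A) * (x * y) * ↑a⁻¹ = (a * x * ↑a⁻¹) * (a * y * ↑a⁻¹) := by simp [mul_assoc]
      rw [this]
      exact B.mul_mem hx hy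

end ThinBasis

/-! ### Paths in tree quivers -/

namespace IsTreeQuiver

variable {V : Type w} [Quiver.{v} V]

/-- The vertices on the side of the target of an arrow `x ⟶ y` after removing this arrow. -/
def TargetSide (x y c : V) : Prop :=
  ((SimpleGraph.fromRel fun i j : V => Nonempty (i ⟶ j)).deleteEdges {s(x, y)}).Reachable c y

/-- Every edge of a tree is a bridge. -/
theorem not_targetSide (hQ : IsTreeQuiver V) {x y : V} (α : x ⟶ y) : ¬ TargetSide x y x := by
  have hxy : x ≠ y := fun h => by subst h; exact (hQ.1 x).false α
  have h := SimpleGraph.isAcyclic_iff_forall_adj_isBridge.mp hQ.2.2.2.isAcyclic (v := x) (w := y)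
    ((SimpleGraph.fromRel_adj _ _ _).mpr ⟨hxy, Or.inl ⟨α⟩⟩)
  exact SimpleGraph.isBridge_iff.mp h

theorem targetSide_iff (hQ : IsTreeQuiver V) {x y c d : V} (β : c ⟶ d)
    (h : s(c, d) ≠ s(x, y)) : TargetSide x y c ↔ TargetSide x y d := by
  have hcd : c ≠ d := fun h => by subst h; exact (hQ.1 c).false β
  have hadj : ((SimpleGraph.fromRel fun i j : V => Nonempty (i ⟶ j)).deleteEdges
      {s(x, y)}).Adj c d := by
    rw [SimpleGraph.deleteEdges_adj, SimpleGraph.fromRel_adj]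
    exact ⟨⟨hcd, Or.inl ⟨β⟩⟩, h⟩
  exact ⟨fun h => hadj.symm.reachable.trans h, fun h => hadj.reachable.trans h⟩

theorem eq_or_ne (hQ : IsTreeQuiver V) {x y c d : V} (α : x ⟶ y) (β : c ⟶ d) :
    (c = x ∧ d = y) ∨ s(c, d) ≠ s(x, y) := by
  by_cases h : s(c, d) = s(x, y)
  · rcases Sym2.eq_iff.mp h with h | ⟨rfl, rfl⟩
    · exact Or.inl h
    · exact ((hQ.2.2.1 _ _ ⟨α⟩).false β).elim
  · exact Or.inr h

/-- Only the arrow `x ⟶ y` joins the two sides, and it leads to the target side, so no path can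
return. -/
theorem targetSide_mono (hQ : IsTreeQuiver V) {x y : V} (α : x ⟶ y) {c d : V}
    (p : Quiver.Path c d) (h : TargetSide x y c) : TargetSide x y d := by
  induction p with
  | nil => exact h
  | cons p β ih =>
    rcases hQ.eq_or_ne α β with ⟨rfl, rfl⟩ | h1
    · exact SimpleGraph.Reachable.refl _
    · exact (hQ.targetSide_iff β h1).mp ih

theorem isEmpty_path (hQ : IsTreeQuiver V) {x y : V} (α : x ⟶ y) : IsEmpty (Quiver.Path y x) :=
  ⟨fun p => hQ.not_targetSide α (hQ.targetSide_mono α p (SimpleGraph.Reachable.refl _))⟩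

theorem nonempty_path_of_targetSide (hQ : IsTreeQuiver V) {x y : V} (α : x ⟶ y) {c d : V}
    (p : Quiver.Path c d) (hc : ¬ TargetSide x y c) (hd : TargetSide x y d) :
    Nonempty (Quiver.Path y d) := by
  induction p with
  | nil => exact absurd hd hc
  | cons p β ih =>
    rcases hQ.eq_or_ne α β with ⟨rfl, rfl⟩ | h1
    · exact ⟨Quiver.Path.nil⟩
    · obtain ⟨q⟩ := ih ((hQ.targetSide_iff β h1).mpr hd)
      exact ⟨q.cons β⟩

/-- In a tree quiver there is at most one path between any two vertices. -/
theorem subsingleton_path (hQ : IsTreeQuiver V) (i j : V) : Subsingleton (Quiver.Path i j) := by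
  refine ⟨fun p => ?_⟩
  induction p with
  | nil =>
    intro q
    cases q with
    | nil => rfl
    | cons q β => exact ((hQ.isEmpty_path β).false q).elim
  | @cons b j p α ih =>
    intro q
    cases q with
    | nil => exact ((hQ.isEmpty_path α).false p).elim
    | @cons c _ q β =>
      rcases hQ.eq_or_ne α β with ⟨rfl, -⟩ | h1
      · rw [ih q, (hQ.2.1 _ _).elim α β]
      -- If the last arrows differ, then `c` is on the target side of `α` and `i` is not. So `q`
      -- crosses `α` and yields a path `j → c`, which closes an oriented cycle with `β`.
      · have hc := (hQ.targetSide_iff β h1).mpr (SimpleGraph.Reachable.refl _)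
        have hi : ¬ TargetSide b j i := fun h =>
          hQ.not_targetSide α (hQ.targetSide_mono α p h)
        obtain ⟨r⟩ := hQ.nonempty_path_of_targetSide α q hi hc
        exact ((hQ.isEmpty_path β).false r).elim

theorem eq_of_paths (hQ : IsTreeQuiver V) {i j : V} (p : Quiver.Path i j)
    (q : Quiver.Path j i) : i = j := by
  have h := congrArg Quiver.Path.length
    ((hQ.subsingleton_path i i).elim (p.comp q) Quiver.Path.nil)
  rw [Quiver.Path.length_comp, Quiver.Path.length_nil] at h
  exact Quiver.Path.eq_of_length_zero p (by omega)

end IsTreeQuiver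

/-! ### Path algebras of tree quivers -/

namespace PathAlgebra

variable {k : Type u} {V : Type w} [Quiver.{v} V] [Field k]

theorem ext {x y : PathAlgebra k V} (h : ∀ i j, x i j = y i j) : x = y :=
  funext fun i => funext fun j => h i j

theorem sum_apply {ι : Type*} (s : Finset ι) (f : ι → PathAlgebra k V) (i j : V) :
    (∑ x ∈ s, f x) i j = ∑ x ∈ s, f x i j := by
  classical
  induction s using Finset.induction_on with
  | empty => rfl
  | insert x s hx ih => rw [Finset.sum_insert hx, Finset.sum_insert hx, add_apply, ih]

variable [DecidableEq V]

theorem ofPath_apply_self {i j : V} (p : Quiver.Path i j) :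
    (ofPath p : PathAlgebra k V) i j = Finsupp.single p 1 := by
  rw [ofPath, Pi.single_eq_same, Pi.single_eq_same]

theorem ofPath_apply_of_ne_left {i j : V} (p : Quiver.Path i j) {a : V} (h : a ≠ i) (b : V) :
    (ofPath p : PathAlgebra k V) a b = 0 := by
  rw [ofPath, Pi.single_eq_of_ne h]; rfl

theorem ofPath_apply_of_ne_right {i j : V} (p : Quiver.Path i j) (a : V) {b : V} (h : b ≠ j) :
    (ofPath p : PathAlgebra k V) a b = 0 := by
  by_cases ha : a = i
  · subst ha
    rw [ofPath, Pi.single_eq_same, Pi.single_eq_of_ne h]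
  · exact ofPath_apply_of_ne_left p ha b

variable [Fintype V]

theorem ofPath_mul_apply {j l : V} (p : Quiver.Path j l) (y : PathAlgebra k V) (a : V) :
    (ofPath p * y : PathAlgebra k V) a l = compLin (Finsupp.single p 1) (y a j) := by
  rw [mul_apply, Finset.sum_eq_single j, ofPath_apply_self]
  · intro m _ hm
    rw [ofPath_apply_of_ne_left p hm, map_zero, LinearMap.zero_apply]
  · simp

theorem ofPath_mul_apply_of_ne {j l : V} (p : Quiver.Path j l) (y : PathAlgebra k V) (a : V)
    {b : V} (h : b ≠ l) : (ofPath p * y : PathAlgebra k V) a b = 0 := by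
  rw [mul_apply, Finset.sum_eq_zero]
  intro m _
  rw [ofPath_apply_of_ne_right p m h, map_zero, LinearMap.zero_apply]

theorem mul_ofPath_apply {i j : V} (p : Quiver.Path i j) (y : PathAlgebra k V) (b : V) :
    (y * ofPath p : PathAlgebra k V) i b = compLin (y j b) (Finsupp.single p 1) := by
  rw [mul_apply, Finset.sum_eq_single j, ofPath_apply_self]
  · intro m _ hm
    rw [ofPath_apply_of_ne_right p i hm, map_zero]
  · simp

theorem mul_ofPath_apply_of_ne {i j : V} (p : Quiver.Path i j) (y : PathAlgebra k V) {a : V}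
    (b : V) (h : a ≠ i) : (y * ofPath p : PathAlgebra k V) a b = 0 := by
  rw [mul_apply, Finset.sum_eq_zero]
  intro m _
  rw [ofPath_apply_of_ne_left p h m, map_zero]

theorem ofPath_mul_ofPath {i j l : V} (p : Quiver.Path j l) (q : Quiver.Path i j) :
    (ofPath p * ofPath q : PathAlgebra k V) = ofPath (q.comp p) := by
  refine PathAlgebra.ext fun a b => ?_
  by_cases hb : b = l
  · subst hb
    rw [ofPath_mul_apply]
    by_cases ha : a = i
    · subst ha
      rw [ofPath_apply_self, ofPath_apply_self, compLin_single, one_mul]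
    · rw [ofPath_apply_of_ne_left q ha, ofPath_apply_of_ne_left _ ha, map_zero]
  · rw [ofPath_mul_apply_of_ne p _ _ hb, ofPath_apply_of_ne_right _ _ hb]

theorem ofPath_mul_ofPath_of_ne {i j j' l : V} (h : j ≠ j') (p : Quiver.Path j l)
    (q : Quiver.Path i j') : (ofPath p * ofPath q : PathAlgebra k V) = 0 := by
  refine PathAlgebra.ext fun a b => ?_
  by_cases hb : b = l
  · subst hb
    rw [ofPath_mul_apply, ofPath_apply_of_ne_right q a h, map_zero]; rfl
  · rw [ofPath_mul_apply_of_ne p _ _ hb]; rfl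

variable (k) in
/-- The trivial path at a vertex. -/
abbrev trivialPath (i : V) : PathAlgebra k V := ofPath (Quiver.Path.nil : Quiver.Path i i)

theorem sum_trivialPath : ∑ i : V, trivialPath k i = 1 := by
  refine PathAlgebra.ext fun a b => ?_
  simp_rw [sum_apply, trivialPath]
  rw [Finset.sum_eq_single a]
  · by_cases h : b = a
    · subst h
      rw [ofPath_apply_self, one_apply_self]
    · rw [ofPath_apply_of_ne_right _ _ h, one_apply_ne h]
  · intro i _ h
    rw [ofPath_apply_of_ne_left _ h.symm]
  · simp

theorem eq_sum_trivialPath_mul (x : PathAlgebra k V) :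
    x = ∑ j, ∑ i, trivialPath k j * x * trivialPath k i := by
  simp_rw [← Finset.mul_sum, sum_trivialPath, mul_one, ← Finset.sum_mul, sum_trivialPath, one_mul]

theorem trivialPath_mul_mul (hQ : IsTreeQuiver V) (x : PathAlgebra k V) {i j : V}
    (p : Quiver.Path i j) :
    trivialPath k j * x * trivialPath k i = x i j p • ofPath p := by
  have := hQ.subsingleton_path i j
  refine PathAlgebra.ext fun a b => ?_
  rw [smul_apply]
  by_cases ha : a = i
  · subst ha
    rw [mul_ofPath_apply, compLin_nil_right]
    by_cases hb : b = j
    · subst hb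
      rw [ofPath_mul_apply, compLin_nil_left, ofPath_apply_self, Finsupp.smul_single, smul_eq_mul,
        mul_one]
      ext q
      rw [Subsingleton.elim q p, Finsupp.single_eq_same]
    · rw [ofPath_mul_apply_of_ne _ _ _ hb, ofPath_apply_of_ne_right _ _ hb, smul_zero]
  · rw [mul_ofPath_apply_of_ne _ _ _ ha, ofPath_apply_of_ne_left _ ha, smul_zero]

theorem trivialPath_mul_mul_of_isEmpty (x : PathAlgebra k V) {i j : V}
    (h : IsEmpty (Quiver.Path i j)) : trivialPath k j * x * trivialPath k i = 0 := by
  refine PathAlgebra.ext fun a b => ?_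
  rw [zero_apply]
  by_cases ha : a = i
  · subst ha
    rw [mul_ofPath_apply, compLin_nil_right]
    by_cases hb : b = j
    · subst hb
      rw [ofPath_mul_apply, compLin_nil_left, Subsingleton.elim (x a b) 0]
    · rw [ofPath_mul_apply_of_ne _ _ _ hb]
  · rw [mul_ofPath_apply_of_ne _ _ _ ha]

/-- The coefficient of a path of length below two vanishes on the span of all longer paths. -/
theorem IsAdmissible.two_le_length {I : Ideal (PathAlgebra k V)} (hI : IsAdmissible I) {i j : V}
    {p : Quiver.Path i j} (h : ofPath p ∈ I) : 2 ≤ p.length := by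
  by_contra hp
  have key : ∀ x ∈ Submodule.span k {x : PathAlgebra k V | ∃ (i j : V) (p : Quiver.Path i j),
      2 ≤ p.length ∧ x = ofPath p}, x i j p = 0 := by
    intro x hx
    induction hx using Submodule.span_induction with
    | mem x hx =>
      obtain ⟨a, b, q, hq, rfl⟩ := hx
      by_cases ha : i = a
      · by_cases hb : j = b
        · subst ha hb
          rw [ofPath_apply_self, Finsupp.single_eq_of_ne]
          rintro rfl
          exact hp hq
        · rw [ofPath_apply_of_ne_right _ _ hb]; rfl
      · rw [ofPath_apply_of_ne_left _ ha]; rfl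
    | zero => rfl
    | add x y _ _ hx hy => rw [add_apply, Finsupp.add_apply, hx, hy, add_zero]
    | smul c x _ hx => rw [smul_apply, Finsupp.smul_apply, hx, smul_zero]
  have h1 := key _ (hI.2 h)
  rw [ofPath_apply_self, Finsupp.single_eq_same] at h1
  exact one_ne_zero h1

/-- Every admissible ideal of the path algebra of a tree quiver is monomial. -/
theorem isMonomial_of_isTreeQuiver (hQ : IsTreeQuiver V) (I : Ideal (PathAlgebra k V))
    [I.IsTwoSided] (hI : IsAdmissible I) : IsMonomial I := by
  refine ⟨{x | x ∈ I ∧ ∃ (i j : V) (p : Quiver.Path i j), 2 ≤ p.length ∧ x = ofPath p},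
    fun x hx => hx.2, le_antisymm (fun x hx => ?_) fun x hx => ?_⟩
  · rw [← Ideal.mem_toTwoSided]
    exact TwoSidedIdeal.span_le.mpr (fun y hy => Ideal.mem_toTwoSided.mpr hy.1)
      (TwoSidedIdeal.mem_asIdeal.mp hx)
  · rw [eq_sum_trivialPath_mul x]
    refine sum_mem fun j _ => sum_mem fun i _ => ?_
    by_cases hp : Nonempty (Quiver.Path i j)
    · obtain ⟨p⟩ := hp
      have h1 : trivialPath k j * x * trivialPath k i ∈ I :=
        I.mul_mem_right _ (I.mul_mem_left _ hx)
      rw [trivialPath_mul_mul hQ x p] at h1 ⊢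
      by_cases h0 : x i j p = 0
      · rw [h0, zero_smul]; exact zero_mem _
      -- The cut element is a nonzero multiple of one path, so the path itself lies in `I`.
      · have h2 : ofPath p ∈ I := by
          have := I.mul_mem_left (algebraMap k _ (x i j p)⁻¹) h1
          rwa [← Algebra.smul_def, smul_smul, inv_mul_cancel₀ h0, one_smul] at this
        rw [Algebra.smul_def]
        exact Ideal.mul_mem_left _ _ (TwoSidedIdeal.mem_asIdeal.mpr
          (TwoSidedIdeal.subset_span ⟨h2, i, j, p, hI.two_le_length h2, rfl⟩))
    · rw [trivialPath_mul_mul_of_isEmpty x (not_nonempty_iff.mp hp)]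
      exact zero_mem _

variable (k) in
open Classical in
/-- A path `i → j` if there is one, and zero otherwise. -/
def pathElt (j i : V) : PathAlgebra k V :=
  if h : Nonempty (Quiver.Path i j) then ofPath h.some else 0

theorem pathElt_eq (hQ : IsTreeQuiver V) {i j : V} (p : Quiver.Path i j) :
    pathElt k j i = ofPath p := by
  have := hQ.subsingleton_path i j
  rw [pathElt, dif_pos ⟨p⟩, Subsingleton.elim (Nonempty.some _) p]

theorem pathElt_eq_zero {i j : V} (h : ¬ Nonempty (Quiver.Path i j)) : pathElt k j i = 0 :=
  dif_neg h

open Classical in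
/-- The thin basis of a quotient of the path algebra of a tree quiver. -/
def thinBasis (hQ : IsTreeQuiver V) (I : Ideal (PathAlgebra k V)) [I.IsTwoSided]
    (hI : IsAdmissible I) : ThinBasis k (PathAlgebra k V ⧸ I) V where
  elt j i := Ideal.Quotient.mk I (pathElt k j i)
  -- The number of vertices with a path to `i`. It grows strictly along a nontrivial path, whose
  -- target has no path back to the source.
  height i := (Finset.univ.filter fun j => Nonempty (Quiver.Path j i)).card
  sum_elt_self := by
    simp_rw [pathElt_eq hQ Quiver.Path.nil, ← map_sum, sum_trivialPath, map_one]
  elt_self_ne_zero i h := by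
    rw [pathElt_eq hQ Quiver.Path.nil, Ideal.Quotient.eq_zero_iff_mem] at h
    have := hI.two_le_length h
    simp at this
  mul_of_ne {l j j' i} h := by
    by_cases h1 : Nonempty (Quiver.Path j l)
    · by_cases h2 : Nonempty (Quiver.Path i j')
      · obtain ⟨p⟩ := h1
        obtain ⟨q⟩ := h2
        rw [pathElt_eq hQ p, pathElt_eq hQ q, ← map_mul, ofPath_mul_ofPath_of_ne h, map_zero]
      · rw [pathElt_eq_zero h2, map_zero, mul_zero]
    · rw [pathElt_eq_zero h1, map_zero, zero_mul]
  mul_of_ne_zero {l j i} h1 h2 := by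
    have h1 : Nonempty (Quiver.Path j l) := by
      by_contra h; exact h1 (by rw [pathElt_eq_zero h, map_zero])
    have h2 : Nonempty (Quiver.Path i j) := by
      by_contra h; exact h2 (by rw [pathElt_eq_zero h, map_zero])
    obtain ⟨p⟩ := h1
    obtain ⟨q⟩ := h2
    rw [pathElt_eq hQ p, pathElt_eq hQ q, pathElt_eq hQ (q.comp p), ← map_mul, ofPath_mul_ofPath]
  height_lt {j i} h hne := by
    have h1 : Nonempty (Quiver.Path i j) := by
      by_contra h1; exact h (by rw [pathElt_eq_zero h1, map_zero])
    obtain ⟨p⟩ := h1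
    refine Finset.card_lt_card ((Finset.ssubset_iff_of_subset ?_).mpr ⟨j, ?_, ?_⟩)
    · intro m hm
      obtain ⟨q⟩ := (Finset.mem_filter.mp hm).2
      exact Finset.mem_filter.mpr ⟨Finset.mem_univ _, ⟨q.comp p⟩⟩
    · exact Finset.mem_filter.mpr ⟨Finset.mem_univ _, ⟨Quiver.Path.nil⟩⟩
    · intro hj
      obtain ⟨q⟩ := (Finset.mem_filter.mp hj).2
      exact hne (hQ.eq_of_paths q p)
  exists_coeff x j i := by
    obtain ⟨x, rfl⟩ := Ideal.Quotient.mk_surjective x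
    rw [pathElt_eq hQ Quiver.Path.nil, pathElt_eq hQ Quiver.Path.nil, ← map_mul, ← map_mul]
    by_cases h : Nonempty (Quiver.Path i j)
    · obtain ⟨p⟩ := h
      exact ⟨x i j p, by rw [trivialPath_mul_mul hQ x p, pathElt_eq hQ p]; rfl⟩
    · exact ⟨0, by rw [trivialPath_mul_mul_of_isEmpty x (not_nonempty_iff.mp h), map_zero,
        zero_smul]⟩

end PathAlgebra

/-! ### The subalgebra `B_min` of a quotient of the path algebra of a tree quiver -/

section BMin

open PathAlgebra

variable {k : Type u} [Field k] {n : ℕ} [Quiver.{v} (Fin n)] (hQ : IsTreeQuiver (Fin n))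
  (I : Ideal (PathAlgebra k (Fin n))) [I.IsTwoSided] (hI : IsAdmissible I)

theorem vertexIdem_eq : vertexIdem I = (thinBasis hQ I hI).idem :=
  funext fun _ => congrArg (Ideal.Quotient.mk I) (pathElt_eq hQ Quiver.Path.nil).symm

theorem isPathFromTo_iff {i j : Fin n} {x : PathAlgebra k (Fin n) ⧸ I} :
    IsPathFromTo I i j x ↔ x ≠ 0 ∧ x = (thinBasis hQ I hI).elt j i := by
  refine and_congr_right fun hx => ⟨?_, fun h => ?_⟩
  · rintro ⟨p, rfl⟩
    exact congrArg (Ideal.Quotient.mk I) (pathElt_eq hQ p).symm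
  · have h1 : Nonempty (Quiver.Path i j) := by
      by_contra h1
      refine hx (h.trans ?_)
      change Ideal.Quotient.mk I (pathElt k j i) = 0
      rw [pathElt_eq_zero h1, map_zero]
    obtain ⟨p⟩ := h1
    exact ⟨p, h.trans (congrArg (Ideal.Quotient.mk I) (pathElt_eq hQ p))⟩

/-- Having only coefficients `i → j` with `i ≤ j` holds for the generators and is preserved by
products. -/
theorem le_of_mem_bMax {x : PathAlgebra k (Fin n) ⧸ I} (hx : x ∈ bMax I) {j i : Fin n}
    (h : (thinBasis hQ I hI).coeff j i x ≠ 0) : i ≤ j := by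
  set T := thinBasis hQ I hI
  have hidem : ∀ {l j i : Fin n}, T.coeff j i (T.elt l l) ≠ 0 → i ≤ j := by
    intro l j i h
    by_contra hij
    exact h (T.coeff_elt_of_ne fun h1 => hij (h1.2.trans h1.1.symm).le)
  induction hx using Algebra.adjoin_induction generalizing j i with
  | mem x hx =>
    rcases hx with ⟨l, rfl⟩ | ⟨i', j', hij, hx⟩
    · rw [vertexIdem_eq hQ I hI] at h
      exact hidem h
    · rw [((isPathFromTo_iff hQ I hI).mp hx).2] at h
      by_contra hlt
      exact h (T.coeff_elt_of_ne fun h1 => hlt (by rw [h1.1, h1.2]; exact hij.le))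
  | algebraMap r =>
    rw [Algebra.algebraMap_eq_smul_one, ← T.sum_elt_self, map_smul, map_sum] at h
    obtain ⟨l, _, hl⟩ := Finset.exists_ne_zero_of_sum_ne_zero (right_ne_zero_of_mul h)
    exact hidem hl
  | add x y _ _ hx hy =>
    by_cases h0 : T.coeff j i x = 0
    · exact hy fun h1 => h (by rw [map_add, h0, h1, add_zero])
    · exact hx h0
  | mul x y _ _ hx hy =>
    obtain ⟨m, -, h1, h2⟩ := T.exists_of_coeff_mul_ne_zero h
    exact (hy h2).trans (hx h1)

theorem elt_mem_bMax {j i : Fin n} (h0 : (thinBasis hQ I hI).elt j i ≠ 0) (h : i < j) :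
    (thinBasis hQ I hI).elt j i ∈ bMax I :=
  Algebra.subset_adjoin (Or.inr ⟨i, j, h, (isPathFromTo_iff hQ I hI).mpr ⟨h0, rfl⟩⟩)

/-- Elements of both radicals have no diagonal coefficients, so the middle vertex differs from both
ends; membership in `bMax` places it above `i`. -/
theorem exists_of_mem_radMulRad {x : PathAlgebra k (Fin n) ⧸ I} (hx : x ∈ radMulRad I)
    {j i : Fin n} (h : (thinBasis hQ I hI).coeff j i x ≠ 0) :
    ∃ m, i < m ∧ m ≠ j ∧ (thinBasis hQ I hI).Through j m i := by
  set T := thinBasis hQ I hI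
  induction hx using Submodule.mul_induction_on' with
  | mem_mul_mem r hr s hs =>
    obtain ⟨s, hs, rfl⟩ := hs
    have hr := (T.mem_jacobson_iff (f := AlgHom.id k _) Function.injective_id r).mp hr
    have hs := (T.mem_jacobson_iff (f := (bMax I).val) Subtype.val_injective s).mp hs
    obtain ⟨m, hm, h1, h2⟩ := T.exists_of_coeff_mul_ne_zero h
    refine ⟨m, lt_of_le_of_ne (le_of_mem_bMax hQ I hI s.2 h2) ?_, ?_, hm⟩
    · rintro rfl
      exact h2 (hs _)
    · rintro rfl
      exact h1 (hr _)
  | add x _ y _ hx hy =>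
    by_cases h0 : T.coeff j i x = 0
    · exact hy fun h1 => h (by rw [map_add, h0, h1, add_zero])
    · exact hx h0

/-- A factorization through some `m > i` with `m ≠ j` is exactly a product of an element of `rad(A)`
and one of `rad(B_max)`. -/
theorem isRightMinimal_iff {j i : Fin n} (h0 : (thinBasis hQ I hI).elt j i ≠ 0) :
    IsRightMinimal I ((thinBasis hQ I hI).elt j i) ↔
      j = i ∨ (thinBasis hQ I hI).Minimal j i := by
  set T := thinBasis hQ I hI
  have hcoeff : T.coeff j i (T.elt j i) ≠ 0 := by
    rw [T.coeff_elt_self h0]; exact one_ne_zero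
  constructor
  · rintro ⟨h1, h2⟩
    refine or_iff_not_imp_left.mpr fun hji => ⟨h0, ?_, fun m him hm => ?_⟩
    · exact lt_of_le_of_ne (le_of_mem_bMax hQ I hI h1 hcoeff) (Ne.symm hji)
    · by_contra hmj
      refine h2 ?_
      rw [← hm.mul_eq]
      have hmB := elt_mem_bMax hQ I hI hm.right him
      refine Submodule.mul_mem_mul
        ((T.mem_jacobson_iff (f := AlgHom.id k _) Function.injective_id _).mpr fun l => ?_)
        ⟨⟨T.elt m i, hmB⟩,
          (T.mem_jacobson_iff (f := (bMax I).val) Subtype.val_injective _).mpr fun l => ?_, rfl⟩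
      · exact T.char_elt_of_ne (Ne.symm hmj)
      · exact T.char_elt_of_ne him.ne'
  · intro h
    have h1 : ∀ m, i < m → T.Through j m i → m = j := by
      rcases h with rfl | h
      · exact fun m _ hm => T.eq_of_ne_zero hm.right hm.left
      · exact h.2.2
    refine ⟨?_, fun h2 => ?_⟩
    · rcases h with rfl | h
      · exact Algebra.subset_adjoin (Or.inl ⟨j, congrFun (vertexIdem_eq hQ I hI) j⟩)
      · exact elt_mem_bMax hQ I hI h0 h.2.1
    · obtain ⟨m, him, hmj, hm⟩ := exists_of_mem_radMulRad hQ I hI h2 hcoeff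
      exact hmj (h1 m him hm)

theorem bMin_eq : bMin I = (thinBasis hQ I hI).minSubalgebra := by
  unfold bMin ThinBasis.minSubalgebra
  congr 1
  ext x
  constructor
  · rintro ⟨⟨i, j, hx⟩, hmin⟩
    obtain ⟨h0, rfl⟩ := (isPathFromTo_iff hQ I hI).mp hx
    exact ⟨j, i, (isRightMinimal_iff hQ I hI h0).mp hmin, rfl⟩
  · rintro ⟨j, i, h, rfl⟩
    have h0 : (thinBasis hQ I hI).elt j i ≠ 0 := by
      rcases h with rfl | h
      · exact (thinBasis hQ I hI).elt_self_ne_zero j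
      · exact h.1
    exact ⟨⟨i, j, (isPathFromTo_iff hQ I hI).mpr ⟨h0, rfl⟩⟩,
      (isRightMinimal_iff hQ I hI h0).mpr h⟩

end BMin

end

theorem mainTheorem4 {k : Type u} [Field k] {n : ℕ} [Quiver.{v} (Fin n)]
    (hQ : IsTreeQuiver (Fin n))
    (I : Ideal (PathAlgebra k (Fin n))) [I.IsTwoSided] (hI : PathAlgebra.IsAdmissible I)
    (hA : IsQuasiHereditary k (vertexIdem I)) :
    PathAlgebra.IsMonomial I ∧
      ∀ B : Subalgebra k (PathAlgebra k (Fin n) ⧸ I), IsExactBorel k (vertexIdem I) B →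
        ∃ a : (PathAlgebra k (Fin n) ⧸ I)ˣ,
          (B : Set (PathAlgebra k (Fin n) ⧸ I)) =
            {x | ∃ b ∈ bMin I, x = (a : PathAlgebra k (Fin n) ⧸ I) * b * (↑a⁻¹)} := by
  refine ⟨PathAlgebra.isMonomial_of_isTreeQuiver hQ I hI, fun B hB => ?_⟩
  rw [vertexIdem_eq hQ I hI] at hB
  rw [bMin_eq hQ I hI]
  exact (PathAlgebra.thinBasis hQ I hI).exists_conj_of_isExactBorel hB
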